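/- **($\ell^1$-sublinearity of the corrector in dimension one.)** *Environment.* Let $E_1=\{\{x,x+1\}:x\in\mathbb Z\}$, let $\Omega\subseteq(0,\infty)^{\mathbb R\times E_1}$ be a set of environments $\omega=\{\omega_t(e)\}$ that is invariant under the time-space shifts $(\tau_{s,z}\omega)_t(x,y)=\omega_{t+s}(x+z,y+z)$, $(s,z)\in\mathbb R\times\mathbb Z$, and let $\mathcal F$ be a $\sigma$-algebra on $\Omega$ for which all coordinates $\omega\mapsto\omega_t(e)$ are measurable and $(t,\omega)\mapsto\tau_{t,x}\omega$ is jointly measurable for every $x\in\mathbb Z$. Put $\omega_t(x,y)=\omega_t(\{x,y\})$ if $|x-y|=1$ and $\omega_t(x,y)=0$ otherwise, write $x\sim y$ if $|x-y|=1$, and let $(\mathcal L^\omega_t f)(x)=\sum_{y\sim x}\omega_t(x,y)(f(y)-f(x))$. Let $\mathbb P$ be a probability measure on $(\Omega,\mathcal F)$, with expectation $\mathbb E$, such that $\mathbb P\circ\tau_{t,x}^{-1}=\mathbb P$ for all $t\in\mathbb R$, $x\in\mathbb Z$; $\mathbb P[A]\in\{0,1\}$ for each $A\in\mathcal F$ with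 $\tau_{t,x}(A)=A$ for all $t,x$; and $\mathbb E[\omega_t(e)]<\infty$, $\mathbb E[\omega_t(e)^{-1}]<\infty$ for all $t\in\mathbb R$, $e\in E_1$. *Corrector.* $L^2_{\mathrm{cov}}$ is the set of measurable $\Psi:\Omega\times\mathbb Z\to\mathbb R$ such that, for $\mathbb P$-a.e. $\omega$, $\Psi(\tau_{0,x}\omega,y-x)=\Psi(\omega,y)-\Psi(\omega,x)$ for all $x,y\in\mathbb Z$, and such that $\|\Psi\|^2=\mathbb E\big[\sum_{x\sim0}\omega_0(0,x)|\Psi(\omega,x)|^2\big]<\infty$. $L^2_{\mathrm{pot}}$ is the closure in $L^2_{\mathrm{cov}}$ of the set of gradients $D\varphi(\omega,x)=\varphi(\tau_{0,x}\omega)-\varphi(\omega)$ of bounded measurable $\varphi:\Omega\to\mathbb R$. Let $\Phi_0\in L^2_{\mathrm{cov}}$ be such that (i) $\chi_0(\omega,x):=x-\Phi_0(\omega,x)$ belongs to $L^2_{\mathrm{pot}}$; (ii) the function $\Phi(\omega,t,x):=\Phi_0(\tau_{t,0}\omega,x)-\int_0^t\big(\mathcal L^\omega_s\Phi_0(\tau_{s,0}\omega,\cdot)\big)(0)\,ds$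 satisfies, for $\mathbb P$-a.e. $\omega$ and all $x\in\mathbb Z$, $$\partial_t\Phi(\omega,t,x)+\mathcal L^\omega_t\Phi(\omega,t,x)=0,\qquad \Phi(\omega,0,0)=0,$$ in the sense that $t\mapsto\Phi(\omega,t,x)$ agrees for Lebesgue-a.e. $t$ with a function that is absolutely continuous on compact intervals and whose derivative at a.e. $t$ is $-\mathcal L^\omega_t\Phi(\omega,t,x)$. The corrector is $\chi(\omega,t,x):=x-\Phi(\omega,t,x)$. *Statement.* With $B(n)=\{-n,\dots,n\}$, for $\mathbb P$-a.e. $\omega$ the functions $t\mapsto\chi(\omega,t,x)$, $x\in\mathbb Z$, are integrable on compact intervals, and $$\lim_{n\to\infty}\frac1{n^2}\int_0^{n^2}\frac1{|B(n)|}\sum_{x\in B(n)}\Big|\tfrac1n\,\chi(\omega,t,x)\Big|\,dt=0 .$$ -/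

import Mathlib

open MeasureTheory Filter Topology
open scoped ENNReal

noncomputable section

namespace DynRCM

/-- Time-dependent positive weights on the nearest-neighbour edges of `ℤ`.
The edge `{x, x + 1}` is indexed by its left endpoint `x`, so `ω t x` is the weight
`ω_t({x, x + 1})`. -/
abbrev Environment : Type := ℝ → ℤ → Set.Ioi (0 : ℝ)

/-- The time-space shift `(τ_{s,z} ω)_t(x, y) = ω_{t+s}(x + z, y + z)`. -/
def Environment.shift (s : ℝ) (z : ℤ) (ω : Environment) : Environment :=
  fun t x => ω (t + s) (x + z)

/-- The conductance `ω_t(x, y)`: symmetric in `x, y`, and zero unless `|x - y| = 1`. -/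
def Environment.cond (ω : Environment) (t : ℝ) (x y : ℤ) : ℝ :=
  if y = x + 1 then (ω t x : ℝ) else if x = y + 1 then (ω t y : ℝ) else 0

/-- The two neighbours of `x` in `ℤ`. -/
def nbrs (x : ℤ) : Finset ℤ := {x - 1, x + 1}

/-- The generator `(L_t^ω f)(x) = ∑_{y ∼ x} ω_t(x, y) (f y - f x)`. -/
def generator (ω : Environment) (t : ℝ) (f : ℤ → ℝ) (x : ℤ) : ℝ :=
  ∑ y ∈ nbrs x, ω.cond t x y * (f y - f x)

/-- The measurable space `(Ω, 𝓕)` of environments: a shift-invariant set `Ω` of environments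
with a σ-algebra `𝓕` for which the coordinates `ω ↦ ω_t(e)` are measurable and the shifts
`(t, ω) ↦ τ_{t,x} ω` are jointly measurable (so that time integrals along the
shifts make sense). -/
structure EnvSpace where
  /-- the set `Ω` -/
  carrier : Set Environment
  shift_mem : ∀ (s : ℝ) (z : ℤ), ∀ ω ∈ carrier, Environment.shift s z ω ∈ carrier
  /-- the σ-algebra `𝓕` -/
  sigmaAlgebra : MeasurableSpace carrier
  measurable_coord : ∀ (t : ℝ) (x : ℤ), Measurable fun ω : carrier => ω.1 t x
  measurable_shift : ∀ z : ℤ, Measurable fun p : ℝ × carrier =>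
    (⟨Environment.shift p.1 z p.2.1, shift_mem p.1 z p.2.1 p.2.2⟩ : carrier)

variable (E : EnvSpace)

/-- The sample space `Ω`. -/
abbrev EnvSpace.Sample : Type := E.carrier

instance : MeasurableSpace E.Sample := E.sigmaAlgebra

variable {E}

/-- The shift `τ_{s,z}` on `Ω`. -/
def tau (s : ℝ) (z : ℤ) (ω : E.Sample) : E.Sample :=
  ⟨Environment.shift s z ω.1, E.shift_mem s z ω.1 ω.2⟩

/-- Standing assumption on the law of the environment: stationarity and ergodicity with respect to
time-space shifts, and integrability of the conductances and of their inverses. -/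
structure StandingAssumption (P : Measure E.Sample) : Prop where
  prob : IsProbabilityMeasure P
  stationary : ∀ (t : ℝ) (x : ℤ), P.map (tau t x) = P
  ergodic : ∀ A : Set E.Sample, MeasurableSet A →
    (∀ (t : ℝ) (x : ℤ), tau t x '' A = A) → P A = 0 ∨ P A = 1
  integrable : ∀ (t : ℝ) (x : ℤ), Integrable (fun ω : E.Sample => (ω.1 t x : ℝ)) P
  integrable_inv : ∀ (t : ℝ) (x : ℤ), Integrable (fun ω : E.Sample => (ω.1 t x : ℝ)⁻¹) P

/-- The (space) cocycle property. -/
def IsCocycle (P : Measure E.Sample) (Ψ : E.Sample → ℤ → ℝ) : Prop :=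
  ∀ᵐ ω ∂P, ∀ x y : ℤ, Ψ (tau 0 x ω) (y - x) = Ψ ω y - Ψ ω x

/-- The squared norm `‖Ψ‖² = 𝔼[∑_{x ∼ 0} ω_0(0, x) |Ψ(ω, x)|²]`, with values in `[0, ∞]`. -/
def covNormSq (P : Measure E.Sample) (Ψ : E.Sample → ℤ → ℝ) : ℝ≥0∞ :=
  ∫⁻ ω, ∑ x ∈ nbrs 0, ENNReal.ofReal (ω.1.cond 0 0 x * |Ψ ω x| ^ 2) ∂P

/-- Membership in `L²_cov`. -/
structure MemCov (P : Measure E.Sample) (Ψ : E.Sample → ℤ → ℝ) : Prop where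
  measurable : ∀ x : ℤ, Measurable fun ω => Ψ ω x
  cocycle : IsCocycle P Ψ
  norm_lt_top : covNormSq P Ψ < ∞

/-- The (space) gradient `Dφ(ω, x) = φ(τ_{0,x} ω) - φ(ω)`. -/
def grad (φ : E.Sample → ℝ) (ω : E.Sample) (x : ℤ) : ℝ := φ (tau 0 x ω) - φ ω

/-- Membership in `L²_pot`, the closure in `L²_cov` of the gradients of bounded functions. -/
def MemPot (P : Measure E.Sample) (Ψ : E.Sample → ℤ → ℝ) : Prop :=
  MemCov P Ψ ∧ ∀ ε : ℝ≥0∞, 0 < ε → ∃ φ : E.Sample → ℝ,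
    Measurable φ ∧ (∃ C : ℝ, ∀ ω, |φ ω| ≤ C) ∧
      covNormSq P (fun ω x => Ψ ω x - grad φ ω x) < ε

/-- `Φ(ω, t, x) = Φ₀(τ_{t,0} ω, x) - ∫_0^t (L_s^ω Φ₀(τ_{s,0} ω, ·))(0) ds`. -/
def timeSpaceExt (Φ₀ : E.Sample → ℤ → ℝ) (ω : E.Sample) (t : ℝ) (x : ℤ) : ℝ :=
  Φ₀ (tau t 0 ω) x - ∫ s in (0 : ℝ)..t, generator ω.1 s (Φ₀ (tau s 0 ω)) 0

/-- `u` is weakly differentiable on `ℝ` with weak derivative `v`: after modification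
on a Lebesgue null set, `u` is absolutely continuous on compact intervals and differentiable at
almost every time, with derivative `v`. -/
def HasWeakDeriv (u v : ℝ → ℝ) : Prop :=
  ∃ w : ℝ → ℝ, w =ᵐ[volume] u ∧ (∀ a b : ℝ, AbsolutelyContinuousOnInterval w a b) ∧
    ∀ᵐ t : ℝ, HasDerivAt w (v t) t

/-- `Φ₀ ∈ L²_cov` is the time-zero field of a harmonic coordinate `Φ = timeSpaceExt Φ₀`:
`χ₀ = Π - Φ₀` lies in `L²_pot`, and almost surely `∂_t Φ + L_t^ω Φ = 0`, `Φ(ω, 0, 0) = 0`. -/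
structure IsHarmonicField (P : Measure E.Sample) (Φ₀ : E.Sample → ℤ → ℝ) : Prop where
  mem_cov : MemCov P Φ₀
  mem_pot : MemPot P (fun ω x => (x : ℝ) - Φ₀ ω x)
  pde : ∀ᵐ ω ∂P, ∀ x : ℤ, HasWeakDeriv (fun t => timeSpaceExt Φ₀ ω t x)
    (fun t => -generator ω.1 t (timeSpaceExt Φ₀ ω t) x)
  init : ∀ᵐ ω ∂P, timeSpaceExt Φ₀ ω 0 0 = 0

/-- The corrector `χ(ω, t, x) = Π(ω, x) - Φ(ω, t, x)`, where `Π(ω, x) = x`. -/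
def corrector (Φ₀ : E.Sample → ℤ → ℝ) (ω : E.Sample) (t : ℝ) (x : ℤ) : ℝ :=
  (x : ℝ) - timeSpaceExt Φ₀ ω t x

/-- The ball `B(n) = {-n, …, n}` in `ℤ`. -/
def ball (n : ℕ) : Finset ℤ := Finset.Icc (-(n : ℤ)) n

end DynRCM

end

/-! At time `t` the corrector differs from the potential field χ₀(τ_t ω, ·) by a quantity that does
not depend on x. It therefore suffices that its oscillation over {-n, …, n} is o(n) on average over
t ≤ n², and that some spatial mean of it is o(n) uniformly in t ≤ n².

Oscillation: approximate χ₀ by a gradient Dφ with φ bounded. On the line, the oscillation is at most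
2 sup|φ| plus the sum over the box of the edge errors |χ₀ - Dφ|. Since 𝔼[1/ω] is finite, the edge
error has small mean, and a weak-type maximal inequality on boxes of size n × n²
(`ae_exists_forall_parabolic_le`) makes its space-time averages small for all n at once.

Mean: the equation has divergence form, ∂_t χ = j(x) - j(x-1) with a stationary integrable flux j.
Against a triangular weight of mass n² the right side becomes the difference of the sums of j over
{0, …, n-1} and {-n, …, -1}. Its time integral up to t ≤ n² must be o(n³), which says that
space-time averages over adjacent parabolic boxes agree asymptotically (`ae_isBalanced`).
Coboundaries have this property by telescoping and constants trivially; by ergodicity they span a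
dense subspace of L², and the maximal inequality passes to L¹ limits. The mean at a starting time is
controlled by spatial sublinearity (`MemPot.ae_sublinear`), from the same maximal inequality in
space only. -/

/-! ### Stationary space-time flows and averages along orbits. -/

/-- A jointly measurable, measure preserving action of `ℝ × ℤ` on a measure space. -/
structure IsSpaceTimeFlow {Ω : Type*} [MeasurableSpace Ω] (P : Measure Ω)
    (T : ℝ → ℤ → Ω → Ω) : Prop where
  zero : ∀ ω, T 0 0 ω = ω
  add : ∀ s t x y ω, T s x (T t y ω) = T (s + t) (x + y) ω
  measurable_uncurry : ∀ x, Measurable fun p : ℝ × Ω => T p.1 x p.2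
  map_eq : ∀ t x, P.map (T t x) = P

namespace IsSpaceTimeFlow

variable {Ω : Type*} [MeasurableSpace Ω] {P : Measure Ω} {T : ℝ → ℤ → Ω → Ω}

theorem measurable (h : IsSpaceTimeFlow P T) (t : ℝ) (x : ℤ) : Measurable (T t x) :=
  (h.measurable_uncurry x).comp measurable_prodMk_left

theorem measurable_time (h : IsSpaceTimeFlow P T) (x : ℤ) (ω : Ω) :
    Measurable fun t => T t x ω :=
  (h.measurable_uncurry x).comp measurable_prodMk_right

theorem measurePreserving (h : IsSpaceTimeFlow P T) (t : ℝ) (x : ℤ) :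
    MeasurePreserving (T t x) P P :=
  ⟨h.measurable t x, h.map_eq t x⟩

/-- Fubini and stationarity. Only almost every time is reached, since there are uncountably many
shifts. -/
theorem ae_ae_shift [SFinite P] (h : IsSpaceTimeFlow P T) {p : Ω → Prop}
    (hp : ∀ᵐ ω ∂P, p ω) : ∀ᵐ ω ∂P, ∀ᵐ t : ℝ, ∀ x, p (T t x ω) := by
  have hN : P (toMeasurable P {ω | ¬ p ω}) = 0 := by rwa [measure_toMeasurable]
  set N := toMeasurable P {ω | ¬ p ω} with hNdef
  have hNm : MeasurableSet N := measurableSet_toMeasurable _ _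
  have key : ∀ x, ∀ᵐ ω ∂P, ∀ᵐ t : ℝ, T t x ω ∉ N := by
    intro x
    have hm : MeasurableSet {q : ℝ × Ω | T q.1 x q.2 ∉ N} :=
      (h.measurable_uncurry x) hNm.compl
    refine (Measure.ae_ae_comm (μ := volume) (ν := P) (p := fun t ω => T t x ω ∉ N) hm).1 ?_
    refine ae_of_all _ fun t => ?_
    have : P (T t x ⁻¹' N) = 0 := by
      rw [(h.measurePreserving t x).measure_preimage hNm.nullMeasurableSet, hN]
    rw [ae_iff]
    simpa [Set.preimage] using this
  filter_upwards [ae_all_iff.2 key] with ω hω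
  filter_upwards [ae_all_iff.2 hω] with t ht x
  by_contra hc
  exact ht x (subset_toMeasurable _ _ hc)

theorem lintegral_comp (h : IsSpaceTimeFlow P T) (t : ℝ) (x : ℤ) {F : Ω → ℝ≥0∞}
    (hF : Measurable F) : ∫⁻ ω, F (T t x ω) ∂P = ∫⁻ ω, F ω ∂P :=
  (h.measurePreserving t x).lintegral_comp hF

/-- The time averages over unit intervals. -/
noncomputable def unitAverage (T : ℝ → ℤ → Ω → Ω) (F : Ω → ℝ≥0∞) (ω : Ω) : ℝ≥0∞ :=
  ∫⁻ s in Set.Ioc (0 : ℝ) 1, F (T s 0 ω)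

theorem measurable_unitAverage (h : IsSpaceTimeFlow P T) {F : Ω → ℝ≥0∞} (hF : Measurable F) :
    Measurable (unitAverage T F) := by
  refine Measurable.lintegral_prod_right' (f := fun q : Ω × ℝ => F (T q.2 0 q.1)) ?_
  exact hF.comp ((h.measurable_uncurry 0).comp measurable_swap)

theorem lintegral_setLIntegral_shift [SFinite P] (h : IsSpaceTimeFlow P T) {F : Ω → ℝ≥0∞}
    (hF : Measurable F) (s : Set ℝ) (x : ℤ) :
    ∫⁻ ω, (∫⁻ t in s, F (T t x ω)) ∂P = volume s * ∫⁻ ω, F ω ∂P := by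
  rw [lintegral_lintegral_swap]
  · simp_rw [h.lintegral_comp _ _ hF]
    simp [mul_comm]
  · exact (hF.comp ((h.measurable_uncurry x).comp measurable_swap)).aemeasurable

theorem lintegral_unitAverage [SFinite P] (h : IsSpaceTimeFlow P T) {F : Ω → ℝ≥0∞}
    (hF : Measurable F) : ∫⁻ ω, unitAverage T F ω ∂P = ∫⁻ ω, F ω ∂P := by
  simpa [unitAverage] using h.lintegral_setLIntegral_shift hF (Set.Ioc 0 1) 0

theorem unitAverage_shift (h : IsSpaceTimeFlow P T) (F : Ω → ℝ≥0∞) (k : ℕ) (x : ℤ) (ω : Ω) :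
    unitAverage T F (T k x ω) = ∫⁻ s in Set.Ioc (k : ℝ) (k + 1), F (T s x ω) := by
  unfold unitAverage
  simp_rw [h.add, zero_add]
  have := (measurePreserving_add_right (volume : Measure ℝ) (k : ℝ)).setLIntegral_comp_emb
    (MeasurableEquiv.addRight (k : ℝ)).measurableEmbedding (fun s => F (T s x ω)) (Set.Ioc 0 1)
  rw [this]
  simp [add_comm]

theorem setLIntegral_eq_sum_unitAverage (h : IsSpaceTimeFlow P T) (F : Ω → ℝ≥0∞) (N : ℕ)
    (x : ℤ) (ω : Ω) :
    ∫⁻ s in Set.Ioc (0 : ℝ) N, F (T s x ω) =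
      ∑ k ∈ Finset.range N, unitAverage T F (T k x ω) := by
  induction N with
  | zero => simp
  | succ N ih =>
    rw [Finset.sum_range_succ, ← ih, h.unitAverage_shift, ← lintegral_union measurableSet_Ioc]
    · rw [Set.Ioc_union_Ioc_eq_Ioc (by positivity) (by linarith)]
      push_cast; rfl
    · exact Set.Ioc_disjoint_Ioc_of_le le_rfl

end IsSpaceTimeFlow

/-! ### Covering argument and maximal inequalities. -/

/-- A covering inequality for translates `p + Q (n p)` of a family of finite sets. -/
theorem mul_card_le_sum_biUnion {A : Type*} [AddCommGroup A] [DecidableEq A]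
    (Q D : ℕ → Finset A)
    (hD : ∀ m n, m ≤ n → ∀ a ∈ Q m, ∀ b ∈ Q n, b - a ∈ D n) (hQ : ∀ n, (Q n).Nonempty)
    (f : A → ℝ≥0∞) (c : ℝ≥0∞) (n : A → ℕ) (G : Finset A)
    (hG : ∀ p ∈ G, c * (D (n p)).card ≤ ∑ z ∈ Q (n p), f (z + p)) :
    c * G.card ≤ ∑ z ∈ G.biUnion fun p => (Q (n p)).image (· + p), f z := by
  induction G using Finset.strongInduction with
  | H G ih =>
    rcases G.eq_empty_or_nonempty with rfl | hne
    · simp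
    -- Greedy selection: keep the translate of largest index, discard all those that meet it, and
    -- recurse on the rest.
    obtain ⟨q, hq, hmax⟩ := G.exists_max_image n hne
    set S : A → Finset A := fun p => (Q (n p)).image (· + p) with hS
    set G' := G.filter fun p => Disjoint (S p) (S q) with hG'
    have hSne : (S q).Nonempty := (hQ _).image _
    have hsub : G' ⊂ G := by
      refine Finset.filter_ssubset.2 ⟨q, hq, ?_⟩
      rw [disjoint_self]
      exact hSne.ne_empty
    have h1 := ih G' hsub fun p hp => hG p (Finset.filter_subset _ _ hp)
    -- A translate at p meeting the one at q forces p - q into Q (n q) - Q (n p), which lies in D (n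
    -- q) because q has maximal index.
    have hcard : (G.filter fun p => ¬ Disjoint (S p) (S q)).card ≤ (D (n q)).card := by
      rw [← Finset.card_image_of_injective (D (n q)) (add_left_injective q)]
      refine Finset.card_le_card fun p hp => ?_
      obtain ⟨hpG, hnd⟩ := Finset.mem_filter.1 hp
      obtain ⟨z, hz1, hz2⟩ := Finset.not_disjoint_iff.1 hnd
      obtain ⟨a, ha, rfl⟩ := Finset.mem_image.1 hz1
      obtain ⟨b, hb, hab⟩ := Finset.mem_image.1 hz2
      refine Finset.mem_image.2 ⟨b - a, hD _ _ (hmax p hpG) a ha b hb, ?_⟩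
      have : b + q = a + p := hab
      show b - a + q = p
      rw [sub_add_eq_add_sub, this]; abel
    have hdisj : Disjoint (G'.biUnion S) (S q) := by
      rw [Finset.disjoint_biUnion_left]
      exact fun p hp => (Finset.mem_filter.1 hp).2
    have hsum : ∑ z ∈ S q, f z = ∑ z ∈ Q (n q), f (z + q) :=
      Finset.sum_image fun a _ b _ hab => add_left_injective q hab
    calc c * (G.card : ℝ≥0∞)
        = c * G'.card + c * (G.filter fun p => ¬ Disjoint (S p) (S q)).card := by
          rw [← mul_add, ← Nat.cast_add, Finset.card_filter_add_card_filter_not]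
      _ ≤ ∑ z ∈ G'.biUnion S, f z + ∑ z ∈ S q, f z := by
          refine add_le_add h1 ?_
          rw [hsum]
          refine le_trans ?_ (hG q hq)
          gcongr
      _ = ∑ z ∈ G'.biUnion S ∪ S q, f z := (Finset.sum_union hdisj).symm
      _ ≤ _ := by
          refine Finset.sum_le_sum_of_subset (Finset.union_subset ?_ ?_)
          · exact Finset.biUnion_subset_biUnion_of_subset_left _ (Finset.filter_subset _ _)
          · exact Finset.subset_biUnion_of_mem S hq

/-- The ratio of the two squares tends to 1 as R → ∞: enlarging a large box by a fixed margin M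
costs nothing in the limit. -/
theorem ENNReal.le_of_sq_mul_le {a b : ℝ≥0∞} (M : ℕ)
    (h : ∀ R : ℕ, ((2 * R + 1) ^ 2 : ℕ) * a ≤ ((2 * (R + M) + 1) ^ 2 : ℕ) * b) : a ≤ b := by
  rcases eq_or_ne b ∞ with rfl | hb
  · exact le_top
  have ha : a ≠ ∞ := by
    intro ha
    have := h 0
    simp only [ha] at this
    rw [ENNReal.mul_top (by simp)] at this
    exact absurd this (not_le.2 (ENNReal.mul_lt_top (ENNReal.natCast_lt_top _) hb.lt_top))
  lift a to NNReal using ha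
  lift b to NNReal using hb
  rw [ENNReal.coe_le_coe, ← NNReal.coe_le_coe]
  have h' : ∀ R : ℕ, (a : ℝ) ≤ (1 + (2 * M) * (1 / (R + 1 : ℝ))) ^ 2 * b := by
    intro R
    have h1 : ((2 * (R : ℝ) + 1) ^ 2) * a ≤ ((2 * (R + M) + 1) ^ 2) * b := by
      exact_mod_cast h R
    have hpos : (0 : ℝ) < 2 * R + 1 := by positivity
    have h2 : (a : ℝ) ≤ (1 + (2 * M) * (1 / (2 * R + 1 : ℝ))) ^ 2 * b := by
      rw [show (1 + (2 * (M : ℝ)) * (1 / (2 * R + 1 : ℝ))) ^ 2 * (b : ℝ)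
        = ((2 * (R + M) + 1) ^ 2 * b) / (2 * R + 1) ^ 2 by field_simp; ring]
      rw [le_div_iff₀ (by positivity)]
      linarith
    refine h2.trans ?_
    have : (1 : ℝ) / (2 * R + 1) ≤ 1 / (R + 1) := by
      apply one_div_le_one_div_of_le <;> [positivity; linarith [(Nat.cast_nonneg R : (0:ℝ) ≤ R)]]
    gcongr
  have hlim : Tendsto (fun R : ℕ => (1 + (2 * (M : ℝ)) * (1 / (R + 1 : ℝ))) ^ 2 * (b : ℝ)) atTop
      (𝓝 ((1 + 2 * (M : ℝ) * 0) ^ 2 * b)) :=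
    ((tendsto_const_nhds.add (tendsto_one_div_add_atTop_nhds_zero_nat.const_mul _)).pow 2).mul_const _
  simpa using ge_of_tendsto' hlim h'

namespace IsSpaceTimeFlow

variable {Ω : Type*} [MeasurableSpace Ω] {P : Measure Ω} {T : ℝ → ℤ → Ω → Ω}

/-- The restriction of the flow to integer times. -/
def lattice (T : ℝ → ℤ → Ω → Ω) (p : ℤ × ℤ) (ω : Ω) : Ω := T p.1 p.2 ω

theorem lattice_add (h : IsSpaceTimeFlow P T) (p q : ℤ × ℤ) (ω : Ω) :
    lattice T p (lattice T q ω) = lattice T (p + q) ω := by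
  simp [lattice, h.add]

theorem measurable_lattice (h : IsSpaceTimeFlow P T) (p : ℤ × ℤ) : Measurable (lattice T p) :=
  h.measurable _ _

/-- The set where an average over `Q n`, `1 ≤ n ≤ N`, is large. -/
def exceedSet (T : ℝ → ℤ → Ω → Ω) (Q D : ℕ → Finset (ℤ × ℤ)) (F : Ω → ℝ≥0∞) (c : ℝ≥0∞)
    (N : ℕ) : Set Ω :=
  {ω | ∃ n ≤ N, c * (D n).card ≤ ∑ z ∈ Q n, F (lattice T z ω)}

theorem measurableSet_exceedSet (h : IsSpaceTimeFlow P T) (Q D : ℕ → Finset (ℤ × ℤ))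
    {F : Ω → ℝ≥0∞} (hF : Measurable F) (c : ℝ≥0∞) (N : ℕ) :
    MeasurableSet (exceedSet T Q D F c N) := by
  have : exceedSet T Q D F c N =
      ⋃ n, ⋃ (_ : n ≤ N), {ω | c * (D n).card ≤ ∑ z ∈ Q n, F (lattice T z ω)} := by
    ext; simp [exceedSet]
  rw [this]
  refine MeasurableSet.iUnion fun n => MeasurableSet.iUnion fun _ => ?_
  exact measurableSet_le measurable_const
    (Finset.measurable_sum _ fun z _ => hF.comp (h.measurable_lattice z))

/-- The square `{-R, …, R}²`. -/
noncomputable def square (R : ℕ) : Finset (ℤ × ℤ) := Finset.Icc (-(R : ℤ)) R ×ˢ Finset.Icc (-(R : ℤ)) R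

theorem card_square (R : ℕ) : (square R).card = (2 * R + 1) ^ 2 := by
  have : (Finset.Icc (-(R : ℤ)) R).card = 2 * R + 1 := by rw [Int.card_Icc]; omega
  rw [square, Finset.card_product, this, sq]

theorem exists_subset_square (S : Finset (ℤ × ℤ)) : ∃ M, S ⊆ square M := by
  refine ⟨S.sup fun p => p.1.natAbs ⊔ p.2.natAbs, fun p hp => ?_⟩
  have := Finset.le_sup (f := fun p : ℤ × ℤ => p.1.natAbs ⊔ p.2.natAbs) hp
  simp only [square, Finset.mem_product, Finset.mem_Icc]
  have h1 := (le_max_left _ _).trans this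
  have h2 := (le_max_right _ _).trans this
  omega

/-- Transference: along each orbit, the covering inequality bounds the number of visits to the
exceedance set in a square of radius R by a sum of F over a slightly larger square. Integration and
stationarity turn both counts into multiples of the mean. The cutoff N keeps the margin M finite. -/
theorem mul_measure_exceedSet_le (h : IsSpaceTimeFlow P T) (Q D : ℕ → Finset (ℤ × ℤ))
    (hD : ∀ m n, m ≤ n → ∀ a ∈ Q m, ∀ b ∈ Q n, b - a ∈ D n) (hQ : ∀ n, (Q n).Nonempty)
    {F : Ω → ℝ≥0∞} (hF : Measurable F) (c : ℝ≥0∞) (N : ℕ) :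
    c * P (exceedSet T Q D F c N) ≤ ∫⁻ ω, F ω ∂P := by
  classical
  set A := exceedSet T Q D F c N with hA
  have hAm : MeasurableSet A := h.measurableSet_exceedSet Q D hF c N
  obtain ⟨M, hM⟩ := exists_subset_square ((Finset.range (N + 1)).biUnion Q)
  refine ENNReal.le_of_sq_mul_le M fun R => ?_
  have hpt : ∀ ω, c * ∑ p ∈ square R, A.indicator 1 (lattice T p ω) ≤
      ∑ z ∈ square (R + M), F (lattice T z ω) := by
    intro ω
    set G := (square R).filter fun p => lattice T p ω ∈ A with hG
    -- Outside G the index is irrelevant and set to 0.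
    have hsel : ∀ p, ∃ n, p ∈ G → n ≤ N ∧
        c * (D n).card ≤ ∑ z ∈ Q n, F (lattice T (z + p) ω) := by
      intro p
      by_cases hp : p ∈ G
      · obtain ⟨n, hn, hle⟩ := (Finset.mem_filter.1 hp).2
        simp_rw [h.lattice_add] at hle
        exact ⟨n, fun _ => ⟨hn, hle⟩⟩
      · exact ⟨0, fun hp' => absurd hp' hp⟩
    choose n hn using hsel
    have hcov := mul_card_le_sum_biUnion Q D hD hQ (fun z => F (lattice T z ω)) c n G
      fun p hp => (hn p hp).2
    have hcount : ∑ p ∈ square R, A.indicator (1 : Ω → ℝ≥0∞) (lattice T p ω) = G.card := by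
      rw [hG, Finset.card_filter]
      push_cast
      exact Finset.sum_congr rfl fun p _ => by simp [Set.indicator_apply]
    rw [hcount]
    refine hcov.trans (Finset.sum_le_sum_of_subset ?_)
    intro z hz
    obtain ⟨p, hp, hz⟩ := Finset.mem_biUnion.1 hz
    obtain ⟨a, ha, rfl⟩ := Finset.mem_image.1 hz
    have h1 := hM (Finset.mem_biUnion.2 ⟨n p, Finset.mem_range.2
      (Nat.lt_succ_of_le (hn p hp).1), ha⟩)
    have h2 := (Finset.mem_filter.1 hp).1
    simp only [square, Finset.mem_product, Finset.mem_Icc, Prod.fst_add, Prod.snd_add] at h1 h2 ⊢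
    push_cast
    omega
  have hint := lintegral_mono (μ := P) hpt
  have hAi : Measurable (A.indicator (1 : Ω → ℝ≥0∞)) := measurable_one.indicator hAm
  have hAz : ∀ z ∈ square R, Measurable fun ω => A.indicator (1 : Ω → ℝ≥0∞) (lattice T z ω) :=
    fun z _ => hAi.comp (h.measurable_lattice z)
  have hFz : ∀ z ∈ square (R + M), Measurable fun ω => F (lattice T z ω) :=
    fun z _ => hF.comp (h.measurable_lattice z)
  rw [lintegral_const_mul _ (Finset.measurable_fun_sum _ hAz), lintegral_finsetSum _ hAz,
    lintegral_finsetSum _ hFz] at hint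
  simp only [lattice] at hint
  simp_rw [h.lintegral_comp _ _ hAi, h.lintegral_comp _ _ hF] at hint
  rw [lintegral_indicator_one hAm] at hint
  simp only [Finset.sum_const, card_square, nsmul_eq_mul] at hint
  rwa [mul_left_comm] at hint

/-- If the `L¹` norms of `F i` can be made small, then almost surely some `F i` has uniformly
small averages. -/
theorem ae_exists_forall_sum_le (h : IsSpaceTimeFlow P T) (Q D : ℕ → Finset (ℤ × ℤ))
    (hD : ∀ m n, m ≤ n → ∀ a ∈ Q m, ∀ b ∈ Q n, b - a ∈ D n) (hQ : ∀ n, (Q n).Nonempty)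
    {ι : Type*} {F : ι → Ω → ℝ≥0∞} (hF : ∀ i, Measurable (F i))
    (hsmall : ∀ ε : ℝ≥0∞, 0 < ε → ∃ i, ∫⁻ ω, F i ω ∂P < ε) :
    ∀ᵐ ω ∂P, ∀ c : ℝ≥0∞, 0 < c →
      ∃ i, ∀ n, ∑ z ∈ Q n, F i (lattice T z ω) ≤ c * (D n).card := by
  have key : ∀ k : ℕ, ∀ᵐ ω ∂P,
      ∃ i, ∀ n, ∑ z ∈ Q n, F i (lattice T z ω) ≤ (k + 1 : ℝ≥0∞)⁻¹ * (D n).card := by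
    intro k
    set c : ℝ≥0∞ := (k + 1 : ℝ≥0∞)⁻¹ with hc
    have hc0 : c ≠ 0 := by simp [hc]
    have hct : c ≠ ∞ := by simp [hc]
    have hbad : ∀ i, c * P (⋃ N, exceedSet T Q D (F i) c N) ≤ ∫⁻ ω, F i ω ∂P := by
      intro i
      rw [Monotone.measure_iUnion, ENNReal.mul_iSup]
      · exact iSup_le fun N => h.mul_measure_exceedSet_le Q D hD hQ (hF i) c N
      · rintro N M hNM ω ⟨n, hn, hle⟩
        exact ⟨n, hn.trans hNM, hle⟩
    rw [ae_iff]
    -- The bad set lies in the exceedance set of every F i, so c times its measure is below every ∫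
    -- F i; if it were positive, some i would violate this.
    by_contra hne
    set B := {ω | ¬ ∃ i, ∀ n, ∑ z ∈ Q n, F i (lattice T z ω) ≤ c * (D n).card} with hB
    obtain ⟨i, hi⟩ := hsmall (c * P B) (pos_iff_ne_zero.2 (mul_ne_zero hc0 hne))
    refine absurd hi (not_lt.2 (le_trans ?_ (hbad i)))
    gcongr
    intro ω hω
    simp only [hB, Set.mem_ofPred_eq] at hω
    push Not at hω
    obtain ⟨n, hn⟩ := hω i
    exact Set.mem_iUnion.2 ⟨n, n, le_rfl, hn.le⟩
  filter_upwards [ae_all_iff.2 key] with ω hω c hc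
  obtain ⟨k, hk⟩ := ENNReal.exists_inv_nat_lt hc.ne'
  obtain ⟨i, hi⟩ := hω k
  refine ⟨i, fun n => (hi n).trans ?_⟩
  gcongr
  refine le_trans ?_ hk.le
  exact ENNReal.inv_le_inv.2 (by simp)

/-- Uniform smallness of spatial averages. -/
theorem ae_exists_forall_spatial_le (h : IsSpaceTimeFlow P T)
    {ι : Type*} {F : ι → Ω → ℝ≥0∞} (hF : ∀ i, Measurable (F i))
    (hsmall : ∀ ε : ℝ≥0∞, 0 < ε → ∃ i, ∫⁻ ω, F i ω ∂P < ε) :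
    ∀ᵐ ω ∂P, ∀ c : ℝ≥0∞, 0 < c →
      ∃ i, ∀ n : ℕ, 1 ≤ n → ∑ x ∈ Finset.Icc (-(n : ℤ)) n, F i (T 0 x ω) ≤ c * n := by
  filter_upwards [h.ae_exists_forall_sum_le (fun n => {0} ×ˢ Finset.Icc (-(n : ℤ)) n)
    (fun n => {0} ×ˢ Finset.Icc (-2 * (n : ℤ)) (2 * n))
    (by
      rintro m n hmn ⟨a, a'⟩ ha ⟨b, b'⟩ hb
      simp only [Finset.mem_product, Finset.mem_singleton, Finset.mem_Icc, Prod.mk_sub_mk] at *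
      omega)
    (fun n => ⟨(0, 0), by simp⟩) hF hsmall] with ω hω c hc
  -- The difference set has 4n + 1 ≤ 5n points.
  obtain ⟨i, hi⟩ := hω (c / 5) (ENNReal.div_pos hc.ne' (by simp))
  refine ⟨i, fun n hn => ?_⟩
  have h1 := hi n
  rw [Finset.sum_product, Finset.sum_singleton] at h1
  simp only [lattice, Int.cast_zero] at h1
  refine h1.trans ?_
  have hcard : (({0} ×ˢ Finset.Icc (-2 * (n : ℤ)) (2 * n) : Finset (ℤ × ℤ))).card ≤ 5 * n := by
    rw [Finset.card_product, Finset.card_singleton, Int.card_Icc]; omega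
  calc _ ≤ c / 5 * ((5 * n : ℕ) : ℝ≥0∞) := by gcongr
    _ = c * n := by
      push_cast
      rw [← mul_assoc, ENNReal.div_mul_cancel (by simp) (by simp)]

/-- Uniform smallness of averages over parabolic boxes. -/
theorem ae_exists_forall_parabolic_le [SFinite P] (h : IsSpaceTimeFlow P T)
    {ι : Type*} {F : ι → Ω → ℝ≥0∞} (hF : ∀ i, Measurable (F i))
    (hsmall : ∀ ε : ℝ≥0∞, 0 < ε → ∃ i, ∫⁻ ω, F i ω ∂P < ε) :
    ∀ᵐ ω ∂P, ∀ c : ℝ≥0∞, 0 < c →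
      ∃ i, ∀ n : ℕ, 1 ≤ n → ∑ x ∈ Finset.Icc (-(n : ℤ)) n,
        ∫⁻ t in Set.Ioc (0 : ℝ) ((n : ℝ) ^ 2), F i (T t x ω) ≤ c * (n : ℝ≥0∞) ^ 3 := by
  filter_upwards [h.ae_exists_forall_sum_le
    -- Time is discretized through unit averages. The extra index n² keeps the box nonempty at n = 0
    -- and is dropped at the end.
    (fun n => (Finset.range (n ^ 2 + 1)).image (fun k : ℕ => (k : ℤ)) ×ˢ Finset.Icc (-(n : ℤ)) n)
    (fun n => Finset.Icc (-((n ^ 2 : ℕ) : ℤ)) ((n ^ 2 : ℕ) : ℤ) ×ˢ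
      Finset.Icc (-2 * (n : ℤ)) (2 * n))
    (by
      rintro m n hmn ⟨a, a'⟩ ha ⟨b, b'⟩ hb
      have : m ^ 2 ≤ n ^ 2 := Nat.pow_le_pow_left hmn 2
      generalize m ^ 2 = m2 at *
      generalize n ^ 2 = n2 at *
      simp only [Finset.mem_product, Finset.mem_image, Finset.mem_range, Finset.mem_Icc,
        Prod.mk_sub_mk] at *
      obtain ⟨⟨k, hk, rfl⟩, ha'⟩ := ha
      obtain ⟨⟨l, hl, rfl⟩, hb'⟩ := hb
      omega)
    (fun n => ⟨(0, 0), by simp⟩) (fun i => h.measurable_unitAverage (hF i))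
    (fun ε hε => by simpa only [h.lintegral_unitAverage (hF _)] using hsmall ε hε)]
    with ω hω c hc
  -- The difference set has (2n² + 1)(4n + 1) ≤ 15n³ points.
  obtain ⟨i, hi⟩ := hω (c / 15) (ENNReal.div_pos hc.ne' (by simp))
  refine ⟨i, fun n hn => ?_⟩
  have h1 := hi n
  rw [Finset.sum_product_right] at h1
  refine le_trans (Finset.sum_le_sum fun x _ => ?_) (h1.trans ?_)
  · rw [show ((n : ℝ) ^ 2) = ((n ^ 2 : ℕ) : ℝ) by push_cast; rfl,
      h.setLIntegral_eq_sum_unitAverage,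
      Finset.sum_image fun a _ b _ hab => by exact_mod_cast hab]
    simp only [lattice, Int.cast_natCast]
    exact Finset.sum_le_sum_of_subset (Finset.range_mono (Nat.le_succ _))
  · have hcard : (Finset.Icc (-((n ^ 2 : ℕ) : ℤ)) ((n ^ 2 : ℕ) : ℤ) ×ˢ
      Finset.Icc (-2 * (n : ℤ)) (2 * n)).card ≤ 15 * n ^ 3 := by
      rw [Finset.card_product, Int.card_Icc, Int.card_Icc]
      have e1 : ((n ^ 2 : ℕ) + 1 - -((n ^ 2 : ℕ) : ℤ)).toNat = 2 * n ^ 2 + 1 := by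
        generalize n ^ 2 = n2
        omega
      have e2 : (2 * (n : ℤ) + 1 - -2 * n).toNat = 4 * n + 1 := by omega
      rw [e1, e2]
      have h2 : 1 ≤ n ^ 2 := Nat.one_le_pow _ _ hn
      calc (2 * n ^ 2 + 1) * (4 * n + 1) ≤ (3 * n ^ 2) * (5 * n) :=
            Nat.mul_le_mul (by omega) (by omega)
        _ = 15 * n ^ 3 := by ring
    calc _ ≤ c / 15 * ((15 * n ^ 3 : ℕ) : ℝ≥0∞) := by gcongr
      _ = c * (n : ℝ≥0∞) ^ 3 := by
        push_cast
        rw [← mul_assoc, ENNReal.div_mul_cancel (by simp) (by simp)]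

end IsSpaceTimeFlow

/-! ### Ergodicity: averages over adjacent parabolic boxes agree. -/

theorem sum_range_add_le_sum_Icc (a : ℤ → ℝ≥0∞) (n : ℕ) :
    ∑ k ∈ Finset.range n, (a k + a (k - n)) ≤ ∑ x ∈ Finset.Icc (-(n : ℤ)) n, a x := by
  rw [Finset.sum_add_distrib,
    ← Finset.sum_image (g := fun k : ℕ => (k : ℤ)) (f := a) (fun x _ y _ h => by simpa using h),
    ← Finset.sum_image (g := fun k : ℕ => (k : ℤ) - n) (f := a)
      (fun x _ y _ h => by simpa using h), ← Finset.sum_union]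
  · refine Finset.sum_le_sum_of_subset fun x hx => ?_
    simp only [Finset.mem_union, Finset.mem_image, Finset.mem_range] at hx
    rw [Finset.mem_Icc]
    rcases hx with ⟨k, hk, rfl⟩ | ⟨k, hk, rfl⟩ <;> omega
  · rw [Finset.disjoint_left]
    intro x hx hx'
    simp only [Finset.mem_image, Finset.mem_range] at hx hx'
    obtain ⟨k, hk, rfl⟩ := hx
    obtain ⟨l, hl, h⟩ := hx'
    omega

namespace IsSpaceTimeFlow

section Balanced

variable {Ω : Type*} {T : ℝ → ℤ → Ω → Ω}

/-- The difference of the sums of `f` over two adjacent blocks of length `n`. -/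
def blockDiff (T : ℝ → ℤ → Ω → Ω) (f : Ω → ℝ) (n : ℕ) (ω : Ω) (s : ℝ) : ℝ :=
  ∑ k ∈ Finset.range n, (f (T s k ω) - f (T s (k - n) ω))

/-- The space-time averages of `f` over adjacent parabolic boxes are asymptotically equal. -/
def IsBalanced (T : ℝ → ℤ → Ω → Ω) (f : Ω → ℝ) (ω : Ω) : Prop :=
  ∀ c : ℝ, 0 < c → ∀ᶠ n : ℕ in atTop, ∀ t ∈ Set.Icc (0 : ℝ) ((n : ℝ) ^ 2),
    |∫ s in (0 : ℝ)..t, blockDiff T f n ω s| ≤ c * (n : ℝ) ^ 3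

theorem intervalIntegrable_blockDiff {f : Ω → ℝ} {ω : Ω}
    (hω : ∀ x a b, IntervalIntegrable (fun t => f (T t x ω)) volume a b) (n : ℕ) (a b : ℝ) :
    IntervalIntegrable (blockDiff T f n ω) volume a b := by
  have := IntervalIntegrable.sum (Finset.range n) (f := fun (k : ℕ) s =>
    f (T s k ω) - f (T s (k - n) ω)) fun k _ => (hω k a b).sub (hω (k - n) a b)
  have e : blockDiff T f n ω =
      ∑ k ∈ Finset.range n, fun s => f (T s k ω) - f (T s (k - n) ω) := by
    funext s
    simp [blockDiff]
  rwa [e]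

theorem IsBalanced.add {f g : Ω → ℝ} {ω : Ω} (hf : IsBalanced T f ω) (hg : IsBalanced T g ω)
    (hfi : ∀ x a b, IntervalIntegrable (fun t => f (T t x ω)) volume a b)
    (hgi : ∀ x a b, IntervalIntegrable (fun t => g (T t x ω)) volume a b) :
    IsBalanced T (f + g) ω := by
  intro c hc
  filter_upwards [hf (c / 2) (half_pos hc), hg (c / 2) (half_pos hc)] with n h1 h2 t ht
  have : blockDiff T (f + g) n ω = fun s => blockDiff T f n ω s + blockDiff T g n ω s := by
    funext s
    simp only [blockDiff, Pi.add_apply, ← Finset.sum_add_distrib]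
    exact Finset.sum_congr rfl fun _ _ => by ring
  rw [this, intervalIntegral.integral_add (intervalIntegrable_blockDiff hfi n _ _)
    (intervalIntegrable_blockDiff hgi n _ _)]
  refine (abs_add_le _ _).trans ?_
  linarith [h1 t ht, h2 t ht]

theorem IsBalanced.smul {f : Ω → ℝ} {ω : Ω} (hf : IsBalanced T f ω) (a : ℝ) :
    IsBalanced T (a • f) ω := by
  intro c hc
  filter_upwards [hf (c / (|a| + 1)) (by positivity)] with n h1 t ht
  have : blockDiff T (a • f) n ω = fun s => a * blockDiff T f n ω s := by
    funext s
    simp only [blockDiff, Pi.smul_apply, smul_eq_mul, Finset.mul_sum]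
    exact Finset.sum_congr rfl fun _ _ => by ring
  rw [this, intervalIntegral.integral_const_mul, abs_mul]
  calc |a| * _ ≤ (|a| + 1) * (c / (|a| + 1) * (n : ℝ) ^ 3) := by
        gcongr
        · linarith
        · exact h1 t ht
    _ = c * (n : ℝ) ^ 3 := by field_simp

theorem isBalanced_const (a : ℝ) (ω : Ω) : IsBalanced T (fun _ => a) ω := by
  intro c hc
  refine Eventually.of_forall fun n t _ => ?_
  simp only [blockDiff, sub_self, Finset.sum_const_zero, intervalIntegral.integral_zero, abs_zero]
  positivity

theorem eventually_mul_pow_le {C c : ℝ} (hc : 0 < c) :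
    ∀ᶠ n : ℕ in atTop, C * (n : ℝ) ^ 2 ≤ c * (n : ℝ) ^ 3 := by
  obtain ⟨N, hN⟩ := exists_nat_ge (C / c)
  filter_upwards [eventually_ge_atTop N] with n hn
  have : C ≤ c * n := by
    rw [div_le_iff₀ hc] at hN
    have : (N : ℝ) ≤ n := by exact_mod_cast hn
    nlinarith
  calc C * (n : ℝ) ^ 2 ≤ (c * n) * (n : ℝ) ^ 2 := by gcongr
    _ = _ := by ring

end Balanced

variable {Ω : Type*} [MeasurableSpace Ω] {P : Measure Ω} {T : ℝ → ℤ → Ω → Ω}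

/-- The zero-one law for strictly invariant sets extends to almost surely invariant sets. -/
theorem measure_zero_or_one [SFinite P] (h : IsSpaceTimeFlow P T)
    (herg : ∀ A, MeasurableSet A → (∀ t x, T t x '' A = A) → P A = 0 ∨ P A = 1)
    {A : Set Ω} (hA : MeasurableSet A) (hinv : ∀ t x, ∀ᵐ ω ∂P, (T t x ω ∈ A ↔ ω ∈ A)) :
    P A = 0 ∨ P A = 1 := by
  -- The points whose orbit lies in A for almost every time at every site: strictly invariant
  -- because Lebesgue measure is translation invariant, and almost surely equal to A.
  set B : Set Ω := {ω | ∀ᵐ t : ℝ, ∀ x, T t x ω ∈ A} with hB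
  have hBm : MeasurableSet B := by
    have : B = ⋂ x, {ω | volume {t : ℝ | T t x ω ∉ A} = 0} := by
      ext ω
      simp only [hB, ae_all_iff, Set.mem_iInter]
      rfl
    rw [this]
    refine MeasurableSet.iInter fun x => ?_
    have hm : MeasurableSet {q : Ω × ℝ | T q.2 x q.1 ∉ A} :=
      ((h.measurable_uncurry x).comp measurable_swap) hA.compl
    exact (measurable_measure_prodMk_left (ν := (volume : Measure ℝ)) hm) (measurableSet_singleton 0)
  have hfwd : ∀ s y ω, ω ∈ B → T s y ω ∈ B := by
    intro s y ω hω
    have h1 := (measurePreserving_add_right (volume : Measure ℝ) s).quasiMeasurePreserving.ae hω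
    filter_upwards [h1] with t ht x
    rw [h.add]
    exact ht _
  have hBinv : ∀ t x, T t x '' B = B := by
    intro t x
    refine Set.Subset.antisymm (Set.image_subset_iff.2 fun ω hω => hfwd t x ω hω) fun ω hω => ?_
    exact ⟨T (-t) (-x) ω, hfwd _ _ _ hω, by rw [h.add]; simp [h.zero]⟩
  have hAB : B =ᵐ[P] A := by
    have key : ∀ᵐ ω ∂P, ∀ x, ∀ᵐ t : ℝ, (T t x ω ∈ A ↔ ω ∈ A) := by
      refine ae_all_iff.2 fun x => ?_
      have hm : MeasurableSet {q : ℝ × Ω | T q.1 x q.2 ∈ A ↔ q.2 ∈ A} :=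
        MeasurableSet.iff ((h.measurable_uncurry x) hA) (measurable_snd hA)
      exact (Measure.ae_ae_comm (μ := volume) (ν := P)
        (p := fun t ω => (T t x ω ∈ A ↔ ω ∈ A)) hm).1 (ae_of_all _ fun t => hinv t x)
    filter_upwards [key] with ω hω
    have h1 : (∀ᵐ t : ℝ, ∀ x, T t x ω ∈ A) ↔ ∀ᵐ t : ℝ, ω ∈ A := by
      refine eventually_congr ?_
      filter_upwards [ae_all_iff.2 hω] with t ht
      simp [ht]
    rw [eventually_const] at h1
    exact propext h1
  rw [← measure_congr hAB]
  exact herg B hBm hBinv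

theorem ae_eq_const [IsProbabilityMeasure P] (h : IsSpaceTimeFlow P T)
    (herg : ∀ A, MeasurableSet A → (∀ t x, T t x '' A = A) → P A = 0 ∨ P A = 1)
    {f : Ω → ℝ} (hf : Measurable f) (hinv : ∀ t x, ∀ᵐ ω ∂P, f (T t x ω) = f ω) :
    ∃ c, f =ᵐ[P] fun _ => c := by
  refine exists_eventuallyEq_const_of_forall_separating MeasurableSet fun U hU => ?_
  have hUm : MeasurableSet (f ⁻¹' U) := hf hU
  rcases h.measure_zero_or_one herg hUm fun t x => by
    filter_upwards [hinv t x] with ω hω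
    simp [hω] with h0 | h1
  · exact Or.inr (measure_eq_zero_iff_ae_notMem.1 h0)
  · exact Or.inl ((mem_ae_iff_prob_eq_one hUm).2 h1)

theorem ae_intervalIntegrable [SFinite P] (h : IsSpaceTimeFlow P T) {f : Ω → ℝ}
    (hf : Measurable f) (hfi : Integrable f P) :
    ∀ᵐ ω ∂P, ∀ x a b, IntervalIntegrable (fun t => f (T t x ω)) volume a b := by
  have key : ∀ᵐ ω ∂P, ∀ (x : ℤ) (N : ℕ), ∫⁻ t in Set.Icc (-(N : ℝ)) N, ‖f (T t x ω)‖ₑ < ∞ := by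
    refine ae_all_iff.2 fun x => ae_all_iff.2 fun N => ?_
    refine ae_lt_top ?_ ?_
    · exact Measurable.lintegral_prod_right' (f := fun q : Ω × ℝ => ‖f (T q.2 x q.1)‖ₑ)
        (hf.enorm.comp ((h.measurable_uncurry x).comp measurable_swap))
    · rw [h.lintegral_setLIntegral_shift hf.enorm]
      exact ENNReal.mul_ne_top (by simp) hfi.2.ne
  filter_upwards [key] with ω hω x a b
  obtain ⟨N, hN⟩ := exists_nat_ge (max |a| |b|)
  have hon : IntegrableOn (fun t => f (T t x ω)) (Set.Icc (-(N : ℝ)) N) :=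
    ⟨(hf.comp (h.measurable_time x ω)).aestronglyMeasurable, hω x N⟩
  refine intervalIntegrable_iff.2 (hon.mono_set fun t ht => ?_)
  have h1 := abs_le.1 ((le_max_left _ _).trans hN)
  have h2 := abs_le.1 ((le_max_right _ _).trans hN)
  rcases Set.mem_uIoc.1 ht with h3 | h3 <;> constructor <;> linarith

theorem ae_isBalanced_congr [SFinite P] (h : IsSpaceTimeFlow P T) {f g : Ω → ℝ} (hfg : f =ᵐ[P] g)
    (hf : ∀ᵐ ω ∂P, IsBalanced T f ω) : ∀ᵐ ω ∂P, IsBalanced T g ω := by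
  filter_upwards [hf, h.ae_ae_shift hfg] with ω hω hω' c hc
  filter_upwards [hω c hc] with n hn t ht
  convert hn t ht using 2
  refine intervalIntegral.integral_congr_ae ?_
  filter_upwards [hω'] with s hs _
  simp [blockDiff, hs]

/-- Each block sum telescopes to its endpoints, so the integrand is O(1) and the integral O(n²). -/
theorem isBalanced_space_coboundary (h : IsSpaceTimeFlow P T) {g : Ω → ℝ} {C : ℝ}
    (hC : ∀ ω, |g ω| ≤ C) (ω : Ω) : IsBalanced T (fun ω => g (T 0 1 ω) - g ω) ω := by
  intro c hc
  filter_upwards [eventually_mul_pow_le (C := 4 * C) hc] with n hn t ht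
  refine le_trans ?_ hn
  have hb : ∀ s, blockDiff T (fun ω => g (T 0 1 ω) - g ω) n ω s =
      (g (T s n ω) - g (T s 0 ω)) - (g (T s 0 ω) - g (T s (-n) ω)) := by
    intro s
    simp only [blockDiff, h.add, zero_add, Finset.sum_sub_distrib]
    have h1 := Finset.sum_range_sub (fun k : ℕ => g (T s k ω)) n
    have h2 := Finset.sum_range_sub (fun k : ℕ => g (T s (k - n) ω)) n
    simp only [Finset.sum_sub_distrib, Nat.cast_add, Nat.cast_one, Nat.cast_zero, sub_self,
      zero_sub] at h1 h2
    simp_rw [show ∀ k : ℕ, (1 : ℤ) + (k - n) = k + 1 - n from fun k => by ring,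
      show ∀ k : ℕ, (1 : ℤ) + k = k + 1 from fun k => by ring]
    linarith
  have hbound : ∀ s ∈ Set.uIoc 0 t, ‖blockDiff T (fun ω => g (T 0 1 ω) - g ω) n ω s‖ ≤ 4 * C := by
    intro s _
    rw [hb, Real.norm_eq_abs, abs_le]
    have a1 := abs_le.1 (hC (T s n ω))
    have a2 := abs_le.1 (hC (T s 0 ω))
    have a3 := abs_le.1 (hC (T s (-n) ω))
    constructor <;> linarith
  have := intervalIntegral.norm_integral_le_of_norm_le_const hbound
  rw [Real.norm_eq_abs, sub_zero, abs_of_nonneg ht.1] at this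
  have hC0 : 0 ≤ C := (abs_nonneg _).trans (hC ω)
  refine this.trans ?_
  gcongr
  exact ht.2

/-- At each site the time integral telescopes to two intervals of length |r|. With 2n sites the
total is O(n), relaxed to O(n²). -/
theorem isBalanced_time_coboundary (h : IsSpaceTimeFlow P T) {g : Ω → ℝ} (hg : Measurable g)
    {C : ℝ} (hC : ∀ ω, |g ω| ≤ C) (r : ℝ) (ω : Ω) :
    IsBalanced T (fun ω => g (T r 0 ω) - g ω) ω := by
  intro c hc
  filter_upwards [eventually_mul_pow_le (C := 4 * C * |r|) hc] with n hn t ht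
  refine le_trans ?_ hn
  have hC0 : 0 ≤ C := (abs_nonneg _).trans (hC ω)
  have hi : ∀ x a b, IntervalIntegrable (fun s => g (T s x ω)) volume a b := by
    intro x a b
    refine (intervalIntegrable_const (c := C)).mono_fun
      (hg.comp (h.measurable_time x ω)).aestronglyMeasurable (ae_of_all _ fun s => ?_)
    simpa [abs_of_nonneg hC0] using hC _
  have hi' : ∀ x a b, IntervalIntegrable (fun s => g (T (s + r) x ω)) volume a b := by
    intro x a b
    have := (hi x (a + r) (b + r)).comp_add_right r
    simpa using this
  have hone : ∀ x, |∫ s in (0 : ℝ)..t, (g (T (s + r) x ω) - g (T s x ω))| ≤ 2 * C * |r| := by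
    intro x
    rw [intervalIntegral.integral_sub (hi' _ _ _) (hi _ _ _),
      intervalIntegral.integral_comp_add_right (fun s => g (T s x ω)),
      intervalIntegral.integral_interval_sub_interval_comm' (hi _ _ _) (hi _ _ _) (hi _ _ _)]
    have hb : ∀ a b, |∫ s in a..b, g (T s x ω)| ≤ C * |b - a| := by
      intro a b
      rw [← Real.norm_eq_abs]
      exact intervalIntegral.norm_integral_le_of_norm_le_const fun s _ => hC _
    refine (abs_sub _ _).trans ?_
    have b1 := hb t (t + r)
    have b2 := hb 0 (0 + r)
    simp only [add_sub_cancel_left] at b1 b2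
    linarith
  have hb : blockDiff T (fun ω => g (T r 0 ω) - g ω) n ω = fun s => ∑ k ∈ Finset.range n,
      ((g (T (s + r) k ω) - g (T s k ω)) - (g (T (s + r) (k - n) ω) - g (T s (k - n) ω))) := by
    funext s
    simp only [blockDiff, h.add, zero_add, add_comm r s]
  rw [hb, intervalIntegral.integral_finsetSum fun k _ =>
    ((hi' _ _ _).sub (hi _ _ _)).sub ((hi' _ _ _).sub (hi _ _ _))]
  calc _ ≤ ∑ k ∈ Finset.range n, 4 * C * |r| := by
        refine (Finset.abs_sum_le_sum_abs _ _).trans (Finset.sum_le_sum fun k _ => ?_)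
        rw [intervalIntegral.integral_sub ((hi' _ _ _).sub (hi _ _ _))
          ((hi' _ _ _).sub (hi _ _ _))]
        refine (abs_sub _ _).trans ?_
        linarith [hone k, hone (k - n)]
    _ = 4 * C * |r| * n := by simp [mul_comm]
    _ ≤ 4 * C * |r| * (n : ℝ) ^ 2 := by
        gcongr
        exact_mod_cast Nat.le_self_pow two_ne_zero n

/-- The averages of an `L¹` limit of balanced functions are balanced. -/
theorem ae_isBalanced_of_approx [SFinite P] (h : IsSpaceTimeFlow P T) {f : Ω → ℝ}
    (hf : Measurable f) (hfi : Integrable f P)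
    (happ : ∀ ε : ℝ≥0∞, 0 < ε → ∃ g : Ω → ℝ, Measurable g ∧ Integrable g P ∧
      (∀ᵐ ω ∂P, IsBalanced T g ω) ∧ ∫⁻ ω, ‖f ω - g ω‖ₑ ∂P < ε) :
    ∀ᵐ ω ∂P, IsBalanced T f ω := by
  have hpos : ∀ k : ℕ, (0 : ℝ≥0∞) < (k : ℝ≥0∞)⁻¹ := fun k => by simp
  choose g hgm hgi hgb hgε using fun k : ℕ => happ _ (hpos k)
  have hsmall : ∀ ε : ℝ≥0∞, 0 < ε → ∃ k, ∫⁻ ω, ‖f ω - g k ω‖ₑ ∂P < ε := fun ε hε => by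
    obtain ⟨k, hk⟩ := ENNReal.exists_inv_nat_lt hε.ne'
    exact ⟨k, (hgε k).trans hk⟩
  filter_upwards [ae_all_iff.2 hgb, h.ae_intervalIntegrable hf hfi,
    ae_all_iff.2 fun k => h.ae_intervalIntegrable (hgm k) (hgi k),
    h.ae_exists_forall_parabolic_le (fun k => (hf.sub (hgm k)).enorm) hsmall] with ω hb hfI hgI hmax
  intro c hc
  obtain ⟨k, hk⟩ := hmax (ENNReal.ofReal (c / 2)) (by simpa using hc)
  filter_upwards [hb k (c / 2) (half_pos hc), eventually_ge_atTop 1] with n h1 hn t ht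
  have hsplit : ∫ s in (0 : ℝ)..t, blockDiff T f n ω s =
      (∫ s in (0 : ℝ)..t, blockDiff T (f - g k) n ω s) +
        ∫ s in (0 : ℝ)..t, blockDiff T (g k) n ω s := by
    rw [← intervalIntegral.integral_add]
    · congr 1; funext s
      simp only [blockDiff, Pi.sub_apply, ← Finset.sum_add_distrib]
      exact Finset.sum_congr rfl fun _ _ => by ring
    · exact intervalIntegrable_blockDiff (fun x a b => (hfI x a b).sub (hgI k x a b)) n _ _
    · exact intervalIntegrable_blockDiff (hgI k) n _ _
  -- The maximal inequality bounds the error for all n ≥ 1 and all t ≤ n² simultaneously, since the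
  -- two blocks are disjoint parts of {-n, …, n}.
  have hrem : ‖∫ s in (0 : ℝ)..t, blockDiff T (f - g k) n ω s‖ₑ ≤
      ENNReal.ofReal (c / 2) * (n : ℝ≥0∞) ^ 3 := by
    rw [intervalIntegral.integral_of_le ht.1]
    refine (enorm_integral_le_lintegral_enorm _).trans (le_trans ?_ (hk n hn))
    have hm : ∀ x ∈ Finset.Icc (-(n : ℤ)) n, Measurable fun s => ‖(f - g k) (T s x ω)‖ₑ :=
      fun x _ => ((hf.sub (hgm k)).enorm).comp (h.measurable_time x ω)
    rw [← lintegral_finsetSum _ hm]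
    refine (lintegral_mono' (Measure.restrict_mono (Set.Ioc_subset_Ioc_right ht.2) le_rfl)
      fun s => ?_)
    refine le_trans ?_ (sum_range_add_le_sum_Icc (fun x => ‖f (T s x ω) - g k (T s x ω)‖ₑ) n)
    refine (enorm_sum_le _ _).trans (Finset.sum_le_sum fun j _ => ?_)
    exact enorm_sub_le
  have hrem' : |∫ s in (0 : ℝ)..t, blockDiff T (f - g k) n ω s| ≤ c / 2 * (n : ℝ) ^ 3 := by
    rw [← ofReal_norm, Real.norm_eq_abs] at hrem
    rw [← ENNReal.ofReal_natCast, ← ENNReal.ofReal_pow (by positivity),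
      ← ENNReal.ofReal_mul (by positivity)] at hrem
    exact (ENNReal.ofReal_le_ofReal_iff (by positivity)).1 hrem
  rw [hsplit]
  refine (abs_add_le _ _).trans ?_
  linarith [h1 t ht]

/-- Orthogonality to the coboundary of 1_B says that f has equal integrals over B and its preimage
C; by stationarity, f and its shift have equal integrals over C. Every measurable C arises, the
shift being invertible. -/
theorem ae_comp_eq_of_forall_coboundary (h : IsSpaceTimeFlow P T) {f : Ω → ℝ}
    (hf : Integrable f P) (t : ℝ) (x : ℤ)
    (horth : ∀ B, MeasurableSet B →
      ∫ ω, (B.indicator (1 : Ω → ℝ) (T t x ω) - B.indicator 1 ω) * f ω ∂P = 0) :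
    ∀ᵐ ω ∂P, f (T t x ω) = f ω := by
  have hfT : Integrable (fun ω => f (T t x ω)) P :=
    (h.measurePreserving t x).integrable_comp_of_integrable hf
  refine Integrable.ae_eq_of_forall_setIntegral_eq (fun ω => f (T t x ω)) f hfT hf
    fun C hC _ => ?_
  set B := T (-t) (-x) ⁻¹' C with hB
  have hBm : MeasurableSet B := h.measurable _ _ hC
  have hpre : T t x ⁻¹' B = C := by
    ext ω; simp [hB, h.add, h.zero]
  have e0 := horth B hBm
  have e1 : ∀ ω, (B.indicator (1 : Ω → ℝ) (T t x ω) - B.indicator 1 ω) * f ω =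
      C.indicator f ω - B.indicator f ω := by
    intro ω
    have : T t x ω ∈ B ↔ ω ∈ C := by rw [← hpre]; rfl
    by_cases h1 : ω ∈ C <;> by_cases h2 : ω ∈ B <;> simp [Set.indicator, this, h1, h2]
  simp_rw [e1] at e0
  rw [integral_sub (hf.indicator hC) (hf.indicator hBm), integral_indicator hC,
    integral_indicator hBm, sub_eq_zero] at e0
  rw [e0, ← hpre, ← setIntegral_map hBm (by rw [h.map_eq]; exact hf.aestronglyMeasurable)
    (h.measurable t x).aemeasurable, h.map_eq]

variable [IsProbabilityMeasure P]

/-- The balanced square integrable functions. -/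
def balancedSubmodule (h : IsSpaceTimeFlow P T) : Submodule ℝ (Lp ℝ 2 P) where
  carrier := {f | ∀ᵐ ω ∂P, IsBalanced T f ω}
  zero_mem' := h.ae_isBalanced_congr (Lp.coeFn_zero ℝ 2 P).symm
    (ae_of_all _ fun ω => isBalanced_const 0 ω)
  add_mem' := by
    intro f g hf hg
    have hi : ∀ f : Lp ℝ 2 P, Integrable f P := fun f => (Lp.memLp f).integrable (by norm_num)
    refine h.ae_isBalanced_congr (Lp.coeFn_add f g).symm ?_
    filter_upwards [hf, hg, h.ae_intervalIntegrable (Lp.stronglyMeasurable f).measurable (hi f),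
      h.ae_intervalIntegrable (Lp.stronglyMeasurable g).measurable (hi g)] with ω h1 h2 h3 h4
    exact h1.add h2 h3 h4
  smul_mem' := by
    intro c f hf
    refine h.ae_isBalanced_congr (Lp.coeFn_smul c f).symm ?_
    filter_upwards [hf] with ω h1
    exact h1.smul c

/-- As in von Neumann's ergodic theorem: a function orthogonal to all coboundaries is invariant,
hence constant. Constants are balanced too, so this constant is orthogonal to itself and vanishes.
-/
theorem balancedSubmodule_orthogonal (h : IsSpaceTimeFlow P T)
    (herg : ∀ A, MeasurableSet A → (∀ t x, T t x '' A = A) → P A = 0 ∨ P A = 1) :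
    h.balancedSubmoduleᗮ = ⊥ := by
  rw [eq_bot_iff]
  intro f hf
  have hfi : Integrable f P := (Lp.memLp f).integrable (by norm_num)
  have horth : ∀ (g : Ω → ℝ) (hg : MemLp g 2 P), (∀ᵐ ω ∂P, IsBalanced T g ω) →
      ∫ ω, g ω * f ω ∂P = 0 := by
    intro g hg hgb
    have h1 : hg.toLp g ∈ h.balancedSubmodule := h.ae_isBalanced_congr hg.coeFn_toLp.symm hgb
    have h2 := (Submodule.mem_orthogonal _ _).1 hf _ h1
    rw [L2.inner_def] at h2
    rw [← h2]
    refine integral_congr_ae ?_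
    filter_upwards [hg.coeFn_toLp] with ω hω
    simp [hω, mul_comm]
  have hind : ∀ (B : Set Ω) ω, |B.indicator (1 : Ω → ℝ) ω| ≤ 1 := by
    intro B ω
    by_cases hω : ω ∈ B <;> simp [hω]
  have hcob : ∀ (B : Set Ω), MeasurableSet B → ∀ t x,
      MemLp (fun ω => B.indicator (1 : Ω → ℝ) (T t x ω) - B.indicator 1 ω) 2 P := by
    intro B hB t x
    have hm : Measurable (B.indicator (1 : Ω → ℝ)) := measurable_one.indicator hB
    refine MemLp.of_bound ((hm.comp (h.measurable t x)).sub hm).aestronglyMeasurable 2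
      (ae_of_all _ fun ω => ?_)
    rw [Real.norm_eq_abs]
    exact (abs_sub _ _).trans (by linarith [hind B ω, hind B (T t x ω)])
  have htime : ∀ t, ∀ᵐ ω ∂P, f (T t 0 ω) = f ω := fun t =>
    h.ae_comp_eq_of_forall_coboundary hfi t 0 fun B hB => horth _ (hcob B hB t 0)
      (ae_of_all _ fun ω => h.isBalanced_time_coboundary (measurable_one.indicator hB) (hind B) t ω)
  have hspace : ∀ᵐ ω ∂P, f (T 0 1 ω) = f ω :=
    h.ae_comp_eq_of_forall_coboundary hfi 0 1 fun B hB => horth _ (hcob B hB 0 1)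
      (ae_of_all _ fun ω => h.isBalanced_space_coboundary (hind B) ω)
  have hint : ∀ x : ℤ, ∀ᵐ ω ∂P, f (T 0 x ω) = f ω := by
    intro x
    induction x using Int.induction_on with
    | zero => simp [h.zero]
    | succ i ih =>
      filter_upwards [hspace, (h.measurePreserving 0 1).quasiMeasurePreserving.ae ih] with ω h1 h2
      rwa [h.add, zero_add, h1] at h2
    | pred i ih =>
      filter_upwards [ih, (h.measurePreserving 0 (-i - 1)).quasiMeasurePreserving.ae hspace]
        with ω h1 h2
      rw [h.add, zero_add, show (1 : ℤ) + (-i - 1) = -i by ring, h1] at h2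
      exact h2.symm
  have hall : ∀ t x, ∀ᵐ ω ∂P, f (T t x ω) = f ω := by
    intro t x
    filter_upwards [hint x, (h.measurePreserving 0 x).quasiMeasurePreserving.ae (htime t)]
      with ω h1 h2
    rwa [h.add, zero_add, add_zero, h1] at h2
  obtain ⟨c, hc⟩ := h.ae_eq_const herg (Lp.stronglyMeasurable f).measurable hall
  have hc0 := horth (fun _ => 1) (memLp_const 1) (ae_of_all _ fun ω => isBalanced_const 1 ω)
  simp only [one_mul] at hc0
  rw [integral_congr_ae hc] at hc0
  have : c = 0 := by simpa using hc0
  rw [Submodule.mem_bot, Lp.eq_zero_iff_ae_eq_zero]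
  filter_upwards [hc] with ω hω
  simp [hω, this]

/-- Under ergodicity, space-time averages of an integrable function over adjacent parabolic boxes
are asymptotically equal. -/
theorem ae_isBalanced (h : IsSpaceTimeFlow P T)
    (herg : ∀ A, MeasurableSet A → (∀ t x, T t x '' A = A) → P A = 0 ∨ P A = 1)
    {f : Ω → ℝ} (hf : Measurable f) (hfi : Integrable f P) : ∀ᵐ ω ∂P, IsBalanced T f ω := by
  refine h.ae_isBalanced_of_approx hf hfi fun ε hε => ?_
  have hε2 : 0 < ε / 2 := ENNReal.half_pos hε.ne'
  -- Pass through a simple function to enter L², where balanced functions are dense; on a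
  -- probability space the L² error dominates the L¹ error.
  obtain ⟨s, hs, -⟩ := (memLp_one_iff_integrable.2 hfi).exists_simpleFunc_eLpNorm_sub_lt
    ENNReal.one_ne_top hε2.ne'
  have hs2 : MemLp s 2 P := s.memLp_of_isFiniteMeasure 2 P
  have hdense : hs2.toLp s ∈ closure (h.balancedSubmodule : Set (Lp ℝ 2 P)) := by
    rw [← Submodule.topologicalClosure_coe,
      Submodule.topologicalClosure_eq_top_iff.2 (h.balancedSubmodule_orthogonal herg)]
    trivial
  obtain ⟨g, hg, hdist⟩ := EMetric.mem_closure_iff.1 hdense (ε / 2) hε2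
  have hgm : Measurable g := (Lp.stronglyMeasurable g).measurable
  refine ⟨g, hgm, (Lp.memLp g).integrable (by norm_num), hg, ?_⟩
  rw [Lp.edist_def] at hdist
  have h2 : eLpNorm (⇑s - ⇑g) 2 P < ε / 2 := by
    refine lt_of_eq_of_lt (eLpNorm_congr_ae ?_) hdist
    exact hs2.coeFn_toLp.symm.sub (EventuallyEq.refl _ _)
  have h1 : eLpNorm (⇑s - ⇑g) 1 P < ε / 2 :=
    (eLpNorm_le_eLpNorm_of_exponent_le (by norm_num)
      (s.measurable.sub hgm).aestronglyMeasurable).trans_lt h2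
  calc ∫⁻ ω, ‖f ω - g ω‖ₑ ∂P = eLpNorm (f - ⇑g) 1 P := by
        rw [eLpNorm_one_eq_lintegral_enorm]; rfl
    _ = eLpNorm ((f - ⇑s) + (⇑s - ⇑g)) 1 P := by rw [sub_add_sub_cancel]
    _ ≤ eLpNorm (f - ⇑s) 1 P + eLpNorm (⇑s - ⇑g) 1 P :=
        eLpNorm_add_le (hf.sub s.measurable).aestronglyMeasurable
          (s.measurable.sub hgm).aestronglyMeasurable le_rfl
    _ < ε / 2 + ε / 2 := ENNReal.add_lt_add hs h1
    _ = ε := ENNReal.add_halves ε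

end IsSpaceTimeFlow

/-! ### Oscillation and triangular averages on the integers. -/

theorem abs_sub_le_sum_Icc (g : ℤ → ℝ) {n : ℕ} {x y : ℤ} (hx : x ∈ Finset.Icc (-(n : ℤ)) n)
    (hy : y ∈ Finset.Icc (-(n : ℤ)) n) :
    |g x - g y| ≤ ∑ z ∈ Finset.Icc (-(n : ℤ)) n, |g (z + 1) - g z| := by
  wlog hxy : x ≤ y generalizing x y
  · rw [abs_sub_comm]
    exact this hy hx (le_of_not_ge hxy)
  have key : ∀ y, x ≤ y → |g x - g y| ≤ ∑ z ∈ Finset.Ico x y, |g (z + 1) - g z| := by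
    intro y hxy
    induction y, hxy using Int.leInduction with
    | base => simp
    | succ y hxy ih =>
      have : Finset.Ico x (y + 1) = insert y (Finset.Ico x y) := by
        ext z; simp only [Finset.mem_Ico, Finset.mem_insert]; omega
      rw [this, Finset.sum_insert (by simp)]
      have h1 := abs_sub_le (g x) (g y) (g (y + 1))
      rw [abs_sub_comm (g y)] at h1
      linarith
  refine (key y hxy).trans (Finset.sum_le_sum_of_subset_of_nonneg ?_ fun _ _ _ => abs_nonneg _)
  intro z hz
  simp only [Finset.mem_Icc, Finset.mem_Ico] at *
  omega

/-- The unnormalized average of `g` with respect to a triangular weight on `{1 - n, …, n - 1}`. -/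
def triangularSum (n : ℕ) (g : ℤ → ℝ) : ℝ :=
  ∑ k ∈ Finset.range n, ∑ i ∈ Finset.range n, g (i + k + 1 - n)

/-- The triangular weight is a convolution of two block indicators; a discrete derivative telescopes
in one of them and leaves a block difference in the other. -/
theorem triangularSum_sub_pred (n : ℕ) (F : ℤ → ℝ) :
    triangularSum n (fun y => F y - F (y - 1)) = ∑ k ∈ Finset.range n, (F k - F (k - n)) := by
  refine Finset.sum_congr rfl fun k _ => ?_
  have := Finset.sum_range_sub (fun i : ℕ => F (i + k - n)) n
  simp only [Nat.cast_zero, zero_add, add_sub_cancel_left] at this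
  rw [← this]
  refine Finset.sum_congr rfl fun i _ => ?_
  dsimp only
  rw [show ((i + 1 : ℕ) : ℤ) + k - n = i + k + 1 - n by push_cast; ring,
    show (i : ℤ) + k + 1 - n - 1 = i + k - n by ring]

theorem triangularSum_add (n : ℕ) (f g : ℤ → ℝ) :
    triangularSum n (fun y => f y + g y) = triangularSum n f + triangularSum n g := by
  simp only [triangularSum, Finset.sum_add_distrib]

theorem abs_triangularSum_le {n : ℕ} {g : ℤ → ℝ} {R : ℝ}
    (hg : ∀ y ∈ Finset.Icc (-(n : ℤ)) n, |g y| ≤ R) :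
    |triangularSum n g| ≤ (n : ℝ) ^ 2 * R := by
  calc |triangularSum n g| ≤ ∑ k ∈ Finset.range n, ∑ i ∈ Finset.range n, R := by
        refine (Finset.abs_sum_le_sum_abs _ _).trans (Finset.sum_le_sum fun k hk => ?_)
        refine (Finset.abs_sum_le_sum_abs _ _).trans (Finset.sum_le_sum fun i hi => hg _ ?_)
        rw [Finset.mem_range] at hk hi
        rw [Finset.mem_Icc]
        omega
    _ = (n : ℝ) ^ 2 * R := by simp; ring

/-- The weight has total mass n², so a value differs from the weighted mean by at most the
oscillation. -/
theorem abs_le_add_abs_triangularSum {n : ℕ} {g : ℤ → ℝ} {R : ℝ}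
    (hg : ∀ x ∈ Finset.Icc (-(n : ℤ)) n, ∀ y ∈ Finset.Icc (-(n : ℤ)) n, |g x - g y| ≤ R)
    {x : ℤ} (hx : x ∈ Finset.Icc (-(n : ℤ)) n) :
    (n : ℝ) ^ 2 * |g x| ≤ (n : ℝ) ^ 2 * R + |triangularSum n g| := by
  have h1 : triangularSum n (fun y => (g x - g y) + g y) =
      triangularSum n (fun y => g x - g y) + triangularSum n g := triangularSum_add n _ _
  have h2 : triangularSum n (fun y => (g x - g y) + g y) = (n : ℝ) ^ 2 * g x := by
    simp [triangularSum]; ring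
  have h3 := abs_triangularSum_le (hg x hx)
  calc (n : ℝ) ^ 2 * |g x| = |(n : ℝ) ^ 2 * g x| := by
        rw [abs_mul, abs_of_nonneg (sq_nonneg (n : ℝ))]
    _ ≤ _ := by
        rw [← h2, h1]
        exact (abs_add_le _ _).trans (by linarith)

/-! ### Cocycles, fluxes and potential fields. -/

namespace DynRCM

variable {E : EnvSpace} {P : Measure E.Sample}

theorem tau_zero (ω : E.Sample) : tau 0 0 ω = ω := by
  apply Subtype.ext
  funext t x
  simp [tau, Environment.shift]

theorem tau_add (s t : ℝ) (x y : ℤ) (ω : E.Sample) :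
    tau s x (tau t y ω) = tau (s + t) (x + y) ω := by
  apply Subtype.ext
  funext u z
  simp [tau, Environment.shift, add_assoc]

theorem StandingAssumption.isSpaceTimeFlow (hP : StandingAssumption P) :
    IsSpaceTimeFlow P (tau (E := E)) where
  zero := tau_zero
  add := tau_add
  measurable_uncurry := E.measurable_shift
  map_eq := hP.stationary

/-- The conductance of the edge `{0, 1}` at time `0`. -/
def cond₀ (ω : E.Sample) : ℝ := ω.1 0 0

theorem cond₀_pos (ω : E.Sample) : 0 < cond₀ ω := (ω.1 0 0).2

theorem measurable_cond₀ : Measurable (cond₀ (E := E)) :=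
  measurable_subtype_coe.comp (E.measurable_coord 0 0)

theorem cond₀_tau (t : ℝ) (x : ℤ) (ω : E.Sample) : cond₀ (tau t x ω) = ω.1 t x := by
  simp [cond₀, tau, Environment.shift]

theorem lintegral_cond₀_mul_sq_le (Ψ : E.Sample → ℤ → ℝ) :
    ∫⁻ ω, ENNReal.ofReal (cond₀ ω * |Ψ ω 1| ^ 2) ∂P ≤ covNormSq P Ψ := by
  refine lintegral_mono fun ω => ?_
  have h1 : (1 : ℤ) ∈ nbrs 0 := by simp [nbrs]
  refine le_trans (le_of_eq ?_) (Finset.single_le_sum (f := fun x =>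
    ENNReal.ofReal (ω.1.cond 0 0 x * |Ψ ω x| ^ 2)) (fun _ _ => zero_le) h1)
  simp [Environment.cond, cond₀]

/-- Young's inequality a ≤ δ/ω + ωa²/δ pointwise. The free δ allows both terms to be made small. -/
theorem lintegral_enorm_le (Ψ : E.Sample → ℤ → ℝ) {δ : ℝ} (hδ : 0 < δ) :
    ∫⁻ ω, ‖Ψ ω 1‖ₑ ∂P ≤ ENNReal.ofReal δ * ∫⁻ ω, ENNReal.ofReal (cond₀ ω)⁻¹ ∂P +
      ENNReal.ofReal δ⁻¹ * covNormSq P Ψ := by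
  have hm : Measurable fun ω : E.Sample => ENNReal.ofReal (cond₀ ω)⁻¹ :=
    measurable_cond₀.inv.ennreal_ofReal
  calc ∫⁻ ω, ‖Ψ ω 1‖ₑ ∂P
      ≤ ∫⁻ ω, (ENNReal.ofReal δ * ENNReal.ofReal (cond₀ ω)⁻¹ +
          ENNReal.ofReal δ⁻¹ * ENNReal.ofReal (cond₀ ω * |Ψ ω 1| ^ 2)) ∂P := by
        refine lintegral_mono fun ω => ?_
        have hc := cond₀_pos ω
        rw [Real.enorm_eq_ofReal_abs, ← ENNReal.ofReal_mul hδ.le,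
          ← ENNReal.ofReal_mul (by positivity), ← ENNReal.ofReal_add (by positivity)
          (by positivity)]
        refine ENNReal.ofReal_le_ofReal ?_
        set a := |Ψ ω 1|
        have : δ * (cond₀ ω)⁻¹ + δ⁻¹ * (cond₀ ω * a ^ 2) - a =
            (δ * cond₀ ω)⁻¹ * ((δ - cond₀ ω * a / 2) ^ 2 + 3 / 4 * (cond₀ ω * a) ^ 2) := by
          field_simp
          ring
        have h0 : 0 ≤ (δ * cond₀ ω)⁻¹ * ((δ - cond₀ ω * a / 2) ^ 2 + 3 / 4 * (cond₀ ω * a) ^ 2) := by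
          positivity
        linarith
    _ = ENNReal.ofReal δ * ∫⁻ ω, ENNReal.ofReal (cond₀ ω)⁻¹ ∂P +
          ENNReal.ofReal δ⁻¹ * ∫⁻ ω, ENNReal.ofReal (cond₀ ω * |Ψ ω 1| ^ 2) ∂P := by
        rw [lintegral_add_left (hm.const_mul _), lintegral_const_mul _ hm,
          lintegral_const_mul' _ _ ENNReal.ofReal_ne_top]
    _ ≤ _ := by gcongr; exact lintegral_cond₀_mul_sq_le Ψ

theorem StandingAssumption.lintegral_inv_lt_top (hP : StandingAssumption P) :
    ∫⁻ ω, ENNReal.ofReal (cond₀ ω)⁻¹ ∂P < ∞ := by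
  have h := (hP.integrable_inv 0 0).2
  refine lt_of_eq_of_lt (lintegral_congr fun ω => ?_) h
  rw [Real.enorm_eq_ofReal_abs, abs_of_nonneg (inv_nonneg.2 (ω.1 0 0).2.le)]
  rfl

theorem MemCov.integrable_step (hP : StandingAssumption P) {Ψ : E.Sample → ℤ → ℝ}
    (hΨ : MemCov P Ψ) : Integrable (fun ω => Ψ ω 1) P := by
  refine ⟨(hΨ.measurable 1).aestronglyMeasurable, ?_⟩
  refine (lintegral_enorm_le Ψ one_pos).trans_lt (ENNReal.add_lt_top.2 ⟨?_, ?_⟩)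
  · exact ENNReal.mul_lt_top ENNReal.ofReal_lt_top hP.lintegral_inv_lt_top
  · exact ENNReal.mul_lt_top ENNReal.ofReal_lt_top hΨ.norm_lt_top

/-- The flux of `Ψ` through the edge `{0, 1}` at time `0`. -/
def flux (Ψ : E.Sample → ℤ → ℝ) (ω : E.Sample) : ℝ := cond₀ ω * Ψ ω 1

theorem MemCov.measurable_flux {Ψ : E.Sample → ℤ → ℝ} (hΨ : MemCov P Ψ) :
    Measurable (flux Ψ) :=
  measurable_cond₀.mul (hΨ.measurable 1)

/-- From ω|Ψ| ≤ ω + ωΨ², both terms being integrable. -/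
theorem MemCov.integrable_flux (hP : StandingAssumption P) {Ψ : E.Sample → ℤ → ℝ}
    (hΨ : MemCov P Ψ) : Integrable (flux Ψ) P := by
  have hc : Integrable (cond₀ (E := E)) P := hP.integrable 0 0
  have hsq : Integrable (fun ω => cond₀ ω * |Ψ ω 1| ^ 2) P := by
    refine ⟨(measurable_cond₀.mul ((hΨ.measurable 1).abs.pow_const 2)).aestronglyMeasurable, ?_⟩
    refine lt_of_eq_of_lt (lintegral_congr fun ω => ?_)
      ((lintegral_cond₀_mul_sq_le Ψ).trans_lt hΨ.norm_lt_top)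
    have := cond₀_pos ω
    rw [Real.enorm_eq_ofReal_abs, abs_of_nonneg (by positivity)]
  refine (hc.add hsq).mono' hΨ.measurable_flux.aestronglyMeasurable (ae_of_all _ fun ω => ?_)
  have := cond₀_pos ω
  rw [flux, Real.norm_eq_abs, abs_mul, abs_of_pos this, Pi.add_apply]
  nlinarith [mul_nonneg this.le (sq_nonneg (|Ψ ω 1| - 1)), mul_nonneg this.le (abs_nonneg (Ψ ω 1))]

/-- The cocycle property at a given environment. -/
def CocycleAt (Ψ : E.Sample → ℤ → ℝ) (ω : E.Sample) : Prop :=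
  ∀ x y : ℤ, Ψ (tau 0 x ω) (y - x) = Ψ ω y - Ψ ω x

theorem CocycleAt.apply_zero {Ψ : E.Sample → ℤ → ℝ} {ω : E.Sample} (h : CocycleAt Ψ ω) :
    Ψ ω 0 = 0 := by
  have := h 0 0
  simpa [tau_zero] using this

theorem CocycleAt.step {Ψ : E.Sample → ℤ → ℝ} {ω : E.Sample} (h : CocycleAt Ψ ω) (x : ℤ) :
    Ψ ω (x + 1) - Ψ ω x = Ψ (tau 0 x ω) 1 := by
  rw [← h x (x + 1), add_sub_cancel_left]

theorem generator_eq (ω : Environment) (t : ℝ) (f : ℤ → ℝ) (x : ℤ) :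
    generator ω t f x =
      (ω t x : ℝ) * (f (x + 1) - f x) - (ω t (x - 1) : ℝ) * (f x - f (x - 1)) := by
  have h1 : (x - 1) ∉ ({x + 1} : Finset ℤ) := by rw [Finset.mem_singleton]; omega
  rw [generator, nbrs, Finset.sum_insert h1, Finset.sum_singleton]
  simp only [Environment.cond]
  rw [if_neg (by omega), if_pos (by omega), if_pos trivial]
  ring

theorem generator_sub_const (ω : Environment) (t : ℝ) (f : ℤ → ℝ) (c : ℝ) (x : ℤ) :
    generator ω t (fun y => f y - c) x = generator ω t f x := by
  simp [generator_eq]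

theorem CocycleAt.generator_eq_flux {Ψ : E.Sample → ℤ → ℝ} {ω : E.Sample} {t : ℝ}
    (h : CocycleAt Ψ (tau t 0 ω)) (x : ℤ) :
    generator ω.1 t (Ψ (tau t 0 ω)) x =
      flux Ψ (tau t x ω) - flux Ψ (tau t (x - 1) ω) := by
  have h1 := h.step (x - 1)
  rw [sub_add_cancel] at h1
  rw [generator_eq, h.step, h1]
  simp [flux, cond₀_tau, tau_add]

/-- The oscillation of a cocycle is controlled by the error of approximating it by the gradient of
a bounded function. -/
theorem CocycleAt.abs_sub_le {Ψ : E.Sample → ℤ → ℝ} {ω : E.Sample} (h : CocycleAt Ψ ω)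
    {φ : E.Sample → ℝ} {C : ℝ} (hC : ∀ ω, |φ ω| ≤ C) {n : ℕ} {x y : ℤ}
    (hx : x ∈ Finset.Icc (-(n : ℤ)) n) (hy : y ∈ Finset.Icc (-(n : ℤ)) n) :
    |Ψ ω x - Ψ ω y| ≤ 2 * C +
      ∑ z ∈ Finset.Icc (-(n : ℤ)) n, |Ψ (tau 0 z ω) 1 - grad φ (tau 0 z ω) 1| := by
  have h1 := abs_sub_le_sum_Icc (fun z => Ψ ω z - φ (tau 0 z ω)) hx hy
  have h2 : ∀ z, (Ψ ω (z + 1) - φ (tau 0 (z + 1) ω)) - (Ψ ω z - φ (tau 0 z ω)) =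
      Ψ (tau 0 z ω) 1 - grad φ (tau 0 z ω) 1 := by
    intro z
    rw [← h.step, grad, tau_add, zero_add, add_comm 1 z]
    ring
  simp only [h2] at h1
  have h3 := abs_le.1 (hC (tau 0 x ω))
  have h4 := abs_le.1 (hC (tau 0 y ω))
  rw [abs_le] at h1 ⊢
  constructor <;> linarith [h1.1, h1.2]

/-- A bounded measurable function on the sample space. -/
abbrev BddMeas (E : EnvSpace) : Type :=
  {φ : E.Sample → ℝ // Measurable φ ∧ ∃ C : ℝ, ∀ ω, |φ ω| ≤ C}

/-- The size of the error on the edge `{0, 1}` when approximating `Ψ` by a gradient. -/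
def gradError (Ψ : E.Sample → ℤ → ℝ) (φ : BddMeas E) (ω : E.Sample) : ℝ≥0∞ :=
  ‖Ψ ω 1 - grad φ.1 ω 1‖ₑ

theorem measurable_gradError (hP : StandingAssumption P) {Ψ : E.Sample → ℤ → ℝ}
    (hΨ : MemCov P Ψ) (φ : BddMeas E) : Measurable (gradError Ψ φ) :=
  ((hΨ.measurable 1).sub
    ((φ.2.1.comp (hP.isSpaceTimeFlow.measurable 0 1)).sub φ.2.1)).enorm

theorem MemPot.exists_gradError_lt (hP : StandingAssumption P) {Ψ : E.Sample → ℤ → ℝ}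
    (hΨ : MemPot P Ψ) (ε : ℝ≥0∞) (hε : 0 < ε) :
    ∃ φ : BddMeas E, ∫⁻ ω, gradError Ψ φ ω ∂P < ε := by
  have hK := hP.lintegral_inv_lt_top
  set K := ∫⁻ ω, ENNReal.ofReal (cond₀ ω)⁻¹ ∂P
  -- First δ is fixed so that δ 𝔼[1/ω] < ε/2; then the gradient is chosen with squared error below
  -- δε/2.
  obtain ⟨δ, hδ, hδK⟩ : ∃ δ : ℝ, 0 < δ ∧ ENNReal.ofReal δ * K < ε / 2 := by
    obtain ⟨d, hd, hdK⟩ := ENNReal.exists_nnreal_pos_mul_lt hK.ne (ENNReal.half_pos hε.ne').ne'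
    exact ⟨d, hd, by simpa using hdK⟩
  have hpos : 0 < ENNReal.ofReal δ * (ε / 2) := by
    refine pos_iff_ne_zero.2 (mul_ne_zero ?_ (ENNReal.half_pos hε.ne').ne')
    simpa using hδ
  obtain ⟨φ, hφ, hC, hlt⟩ := hΨ.2 _ hpos
  refine ⟨⟨φ, hφ, hC⟩, (lintegral_enorm_le (fun ω x => Ψ ω x - grad φ ω x) hδ).trans_lt ?_⟩
  rw [← ENNReal.add_halves ε]
  refine ENNReal.add_lt_add_of_lt_of_le (ENNReal.mul_ne_top ?_ ?_) hδK ?_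
  · exact ENNReal.ofReal_ne_top
  · exact (hlt.trans_le le_top).ne
  · refine (mul_le_mul_right hlt.le _).trans ?_
    rw [← mul_assoc, ← ENNReal.ofReal_mul (by positivity), inv_mul_cancel₀ hδ.ne',
      ENNReal.ofReal_one, one_mul]

/-- Spatial sublinearity of potential fields at a fixed time. -/
theorem MemPot.ae_sublinear (hP : StandingAssumption P) {Ψ : E.Sample → ℤ → ℝ}
    (hΨ : MemPot P Ψ) : ∀ᵐ ω ∂P, ∀ c : ℝ, 0 < c → ∀ᶠ n : ℕ in atTop,
      ∀ x ∈ Finset.Icc (-(n : ℤ)) n, |Ψ ω x| ≤ c * n := by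
  filter_upwards [hΨ.1.cocycle, hP.isSpaceTimeFlow.ae_exists_forall_spatial_le
    (measurable_gradError hP hΨ.1) (hΨ.exists_gradError_lt hP)] with ω hcoc hmax c hc
  obtain ⟨φ, hφ⟩ := hmax (ENNReal.ofReal (c / 2)) (by simpa using hc)
  obtain ⟨C, hC⟩ := φ.2.2
  obtain ⟨N, hN⟩ := exists_nat_ge (2 * C / (c / 2))
  filter_upwards [eventually_ge_atTop (max N 1)] with n hn x hx
  have hn1 : 1 ≤ n := (le_max_right _ _).trans hn
  have h1 := CocycleAt.abs_sub_le hcoc hC hx (y := 0) (by simp)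
  rw [CocycleAt.apply_zero hcoc, sub_zero] at h1
  have h2 := hφ n hn1
  simp only [gradError, Real.enorm_eq_ofReal_abs] at h2
  rw [← ENNReal.ofReal_sum_of_nonneg fun _ _ => abs_nonneg _, ← ENNReal.ofReal_natCast,
    ← ENNReal.ofReal_mul (by positivity), ENNReal.ofReal_le_ofReal_iff (by positivity)] at h2
  have h3 : 2 * C ≤ c / 2 * n := by
    rw [div_le_iff₀ (by positivity)] at hN
    have : (N : ℝ) ≤ n := by exact_mod_cast (le_max_left _ _).trans hn
    nlinarith
  linarith

end DynRCM

/-! ### The corrector: integrated equation and pointwise bound. -/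

namespace DynRCM

variable {E : EnvSpace} {P : Measure E.Sample} {Φ₀ : E.Sample → ℤ → ℝ}

theorem ae_generator_eq_flux {ω : E.Sample}
    (hcoc : ∀ᵐ t : ℝ, CocycleAt Φ₀ (tau t 0 ω)) :
    ∀ᵐ t : ℝ, ∀ x, generator ω.1 t (Φ₀ (tau t 0 ω)) x =
      flux Φ₀ (tau t x ω) - flux Φ₀ (tau t (x - 1) ω) := by
  filter_upwards [hcoc] with t ht x
  exact ht.generator_eq_flux x

theorem generator_timeSpaceExt (ω : E.Sample) (t : ℝ) (x : ℤ) :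
    generator ω.1 t (timeSpaceExt Φ₀ ω t) x = generator ω.1 t (Φ₀ (tau t 0 ω)) x :=
  generator_sub_const ω.1 t (Φ₀ (tau t 0 ω)) _ x

/-- The integrated form of the equation for the time-space extension. -/
theorem exists_integral_representation {ω : E.Sample} {x : ℤ}
    (hcoc : ∀ᵐ t : ℝ, CocycleAt Φ₀ (tau t 0 ω))
    (hpde : HasWeakDeriv (fun t => timeSpaceExt Φ₀ ω t x)
      (fun t => -generator ω.1 t (timeSpaceExt Φ₀ ω t) x)) :
    ∃ w : ℝ → ℝ, (∀ᵐ t : ℝ, w t = timeSpaceExt Φ₀ ω t x) ∧ ∀ s t, w s - w t =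
      ∫ r in s..t, (flux Φ₀ (tau r x ω) - flux Φ₀ (tau r (x - 1) ω)) := by
  obtain ⟨w, hw, hac, hder⟩ := hpde
  refine ⟨w, hw, fun s t => ?_⟩
  have h1 := (hac s t).integral_deriv_eq_sub
  rw [← neg_sub (w t), ← h1, ← intervalIntegral.integral_neg]
  refine intervalIntegral.integral_congr_ae ?_
  filter_upwards [hder, ae_generator_eq_flux hcoc] with r hr hgen _
  rw [hr.deriv, generator_timeSpaceExt, hgen, neg_neg]

theorem corrector_eq (ω : E.Sample) (t : ℝ) (x : ℤ) :
    corrector Φ₀ ω t x = ((x : ℝ) - Φ₀ (tau t 0 ω) x) +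
      ∫ s in (0 : ℝ)..t, generator ω.1 s (Φ₀ (tau s 0 ω)) 0 := by
  rw [corrector, timeSpaceExt]
  ring

/-- The spatial part at x is a sum of unit steps, each integrable along almost every orbit; the
remaining part is a continuous primitive. -/
theorem ae_intervalIntegrable_corrector (hP : StandingAssumption P) (hΦ : MemCov P Φ₀) :
    ∀ᵐ ω ∂P, ∀ x a b, IntervalIntegrable (fun t => corrector Φ₀ ω t x) volume a b := by
  have := hP.prob
  have hT := hP.isSpaceTimeFlow
  filter_upwards [hT.ae_ae_shift hΦ.cocycle,
    hT.ae_intervalIntegrable hΦ.measurable_flux (hΦ.integrable_flux hP),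
    hT.ae_intervalIntegrable (hΦ.measurable 1) (hΦ.integrable_step hP)] with ω hcoc hJ hstep x a b
  have hcoc0 : ∀ᵐ t : ℝ, CocycleAt Φ₀ (tau t 0 ω) := hcoc.mono fun t ht => ht 0
  have hgen : ∀ a b, IntervalIntegrable (fun s => generator ω.1 s (Φ₀ (tau s 0 ω)) 0)
      volume a b := by
    intro a b
    refine ((hJ 0 a b).sub (hJ (0 - 1) a b)).congr_ae (ae_restrict_of_ae ?_)
    filter_upwards [ae_generator_eq_flux hcoc0] with t ht
    exact (ht 0).symm
  have hfield : IntervalIntegrable (fun t => Φ₀ (tau t 0 ω) x) volume a b := by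
    have hsum := IntervalIntegrable.sum (Finset.Icc (-(x.natAbs : ℤ)) x.natAbs)
      (f := fun z t => |Φ₀ (tau t z ω) 1|) fun z _ => (hstep z a b).abs
    refine hsum.mono_fun
      ((hΦ.measurable x).comp (hT.measurable_time 0 ω)).aestronglyMeasurable
      (ae_restrict_of_ae ?_)
    filter_upwards [hcoc0] with t ht
    have h1 := abs_sub_le_sum_Icc (fun z => Φ₀ (tau t 0 ω) z) (n := x.natAbs) (x := x) (y := 0)
      (by rw [Finset.mem_Icc]; omega) (by rw [Finset.mem_Icc]; omega)
    simp only [ht.step, ht.apply_zero, sub_zero, tau_add, zero_add, add_zero] at h1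
    rw [Real.norm_eq_abs, Finset.sum_apply]
    exact h1.trans (le_abs_self _)
  simp only [corrector_eq]
  exact (intervalIntegrable_const.sub hfield).add
    ((intervalIntegral.continuous_primitive hgen 0).intervalIntegrable a b)

/-- The increments in time of the triangular averages of the corrector. -/
theorem triangularSum_corrector_sub {ω : E.Sample}
    (hJ : ∀ x a b, IntervalIntegrable (fun t => flux Φ₀ (tau t x ω)) volume a b)
    {s t : ℝ} (hst : ∀ x, corrector Φ₀ ω t x = corrector Φ₀ ω s x +
      ∫ r in s..t, (flux Φ₀ (tau r x ω) - flux Φ₀ (tau r (x - 1) ω))) (n : ℕ) :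
    triangularSum n (corrector Φ₀ ω t) = triangularSum n (corrector Φ₀ ω s) +
      ((∫ r in (0 : ℝ)..t, IsSpaceTimeFlow.blockDiff tau (flux Φ₀) n ω r) -
        ∫ r in (0 : ℝ)..s, IsSpaceTimeFlow.blockDiff tau (flux Φ₀) n ω r) := by
  have hb := IsSpaceTimeFlow.intervalIntegrable_blockDiff hJ n
  rw [intervalIntegral.integral_interval_sub_left (hb _ _) (hb _ _),
    show corrector Φ₀ ω t = fun x => corrector Φ₀ ω s x +
      ∫ r in s..t, (flux Φ₀ (tau r x ω) - flux Φ₀ (tau r (x - 1) ω)) from funext hst,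
    triangularSum_add]
  congr 1
  have h1 : ∀ r, IsSpaceTimeFlow.blockDiff tau (flux Φ₀) n ω r =
      triangularSum n fun y => flux Φ₀ (tau r y ω) - flux Φ₀ (tau r (y - 1) ω) := fun r =>
    (triangularSum_sub_pred n fun y => flux Φ₀ (tau r y ω)).symm
  simp only [h1, triangularSum]
  have hi : ∀ x, IntervalIntegrable (fun r => flux Φ₀ (tau r x ω) - flux Φ₀ (tau r (x - 1) ω))
      volume s t := fun x => (hJ _ _ _).sub (hJ _ _ _)
  rw [intervalIntegral.integral_finsetSum]
  · refine Finset.sum_congr rfl fun k _ => ?_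
    rw [intervalIntegral.integral_finsetSum]
    exact fun i _ => hi _
  · intro k _
    have := IntervalIntegrable.sum (Finset.range n) (f := fun (i : ℕ) r =>
      flux Φ₀ (tau r (i + k + 1 - n) ω) - flux Φ₀ (tau r (i + k + 1 - n - 1) ω)) fun i _ => hi _
    exact this.congr_ae (ae_of_all _ fun r => by simp)

/-- A pointwise bound for the corrector in a parabolic box, up to the error of approximating the
corrector by a gradient. -/
theorem ae_corrector_bound (hP : StandingAssumption P) (hΦ : IsHarmonicField P Φ₀) :
    ∀ᵐ ω ∂P, ∀ c : ℝ, 0 < c → ∀ φ : BddMeas E, ∀ᶠ n : ℕ in atTop, ∀ᵐ t : ℝ,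
      t ∈ Set.Ioc (0 : ℝ) ((n : ℝ) ^ 2) → ∀ x ∈ ball n, |corrector Φ₀ ω t x| ≤ c * n +
        ∑ z ∈ ball n, |(1 - Φ₀ (tau t z ω) 1) - grad φ.1 (tau t z ω) 1| := by
  have := hP.prob
  have hT := hP.isSpaceTimeFlow
  have hcov := hΦ.mem_cov
  filter_upwards [hT.ae_ae_shift hcov.cocycle, hT.ae_ae_shift hΦ.mem_pot.1.cocycle,
    hT.ae_ae_shift (hΦ.mem_pot.ae_sublinear hP), hΦ.pde,
    hT.ae_intervalIntegrable hcov.measurable_flux (hcov.integrable_flux hP),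
    hT.ae_isBalanced hP.ergodic hcov.measurable_flux (hcov.integrable_flux hP)]
    with ω hcoc hcocχ hsub hpde hJ hbal c hc φ
  have hcoc0 : ∀ᵐ t : ℝ, CocycleAt Φ₀ (tau t 0 ω) := hcoc.mono fun t ht => ht 0
  choose w hw hwint using fun x => exists_integral_representation hcoc0 (hpde x)
  have hw' : ∀ᵐ t : ℝ, ∀ x, w x t = timeSpaceExt Φ₀ ω t x := ae_all_iff.2 hw
  -- The integrated equation and sublinearity are available only at almost every time, so time 0 is
  -- replaced by a good s in (0, 1], which lies in [0, n²] for n ≥ 1.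
  obtain ⟨s, ⟨hs0, hs1⟩, hws, hsubs⟩ : ∃ s ∈ Set.Ioc (0 : ℝ) 1,
      (∀ x, w x s = timeSpaceExt Φ₀ ω s x) ∧ ∀ c : ℝ, 0 < c → ∀ᶠ n : ℕ in atTop,
        ∀ x ∈ Finset.Icc (-(n : ℤ)) n, |(x : ℝ) - Φ₀ (tau s 0 ω) x| ≤ c * n := by
    have hfreq : ∃ᵐ s : ℝ, s ∈ Set.Ioc (0 : ℝ) 1 := by
      rw [frequently_ae_mem_iff]
      simp
    obtain ⟨s, hs, h1, h2⟩ := (hfreq.and_eventually (hw'.and hsub)).exists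
    exact ⟨s, hs, h1, h2 0⟩
  obtain ⟨C, hC⟩ := φ.2.2
  set I := ∫ r in (0 : ℝ)..s, generator ω.1 r (Φ₀ (tau r 0 ω)) 0 with hI
  -- Four shares of cn: the n-independent constants 2C + |I|, the field at time s, and the flux
  -- integrals up to t and up to s.
  have hc4 : 0 < c / 4 := by positivity
  obtain ⟨N, hN⟩ := exists_nat_ge ((2 * C + |I|) / (c / 4))
  filter_upwards [hbal (c / 4) hc4, hsubs (c / 4) hc4, eventually_ge_atTop (max N 1)]
    with n hbn hsn hn
  have hn1 : 1 ≤ n := (le_max_right _ _).trans hn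
  have hn1' : (1 : ℝ) ≤ n := by exact_mod_cast hn1
  have hconst : 2 * C + |I| ≤ c / 4 * n := by
    rw [div_le_iff₀ hc4] at hN
    have : (N : ℝ) ≤ n := by exact_mod_cast (le_max_left _ _).trans hn
    nlinarith
  filter_upwards [hw', hcocχ] with t hwt hct ht x hx
  have hct0 : CocycleAt (fun ω x => (x : ℝ) - Φ₀ ω x) (tau t 0 ω) := hct 0
  set R := ∑ z ∈ ball n, |(1 - Φ₀ (tau t z ω) 1) - grad φ.1 (tau t z ω) 1| with hR
  have hosc : ∀ x ∈ Finset.Icc (-(n : ℤ)) n, ∀ y ∈ Finset.Icc (-(n : ℤ)) n,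
      |corrector Φ₀ ω t x - corrector Φ₀ ω t y| ≤ 2 * C + R := by
    intro x hx y hy
    have := hct0.abs_sub_le hC hx hy
    simp only [tau_add, zero_add, add_zero, Int.cast_one] at this
    rw [corrector_eq, corrector_eq, add_sub_add_right_eq_sub]
    exact this
  have hinc : ∀ x, corrector Φ₀ ω t x = corrector Φ₀ ω s x +
      ∫ r in s..t, (flux Φ₀ (tau r x ω) - flux Φ₀ (tau r (x - 1) ω)) := by
    intro x
    rw [← hwint x s t, hws, hwt, corrector, corrector]
    ring
  have htri := triangularSum_corrector_sub hJ hinc n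
  have hstart : |triangularSum n (corrector Φ₀ ω s)| ≤ (n : ℝ) ^ 2 * (c / 4 * n + |I|) := by
    refine abs_triangularSum_le fun y hy => ?_
    rw [corrector_eq]
    exact (abs_add_le _ _).trans (add_le_add (hsn y hy) le_rfl)
  have hs : s ∈ Set.Icc (0 : ℝ) ((n : ℝ) ^ 2) := ⟨hs0.le, hs1.trans (one_le_pow₀ hn1')⟩
  have hbt := hbn t ⟨ht.1.le, ht.2⟩
  have hbs := hbn s hs
  have hmain := abs_le_add_abs_triangularSum hosc hx
  have habs : |triangularSum n (corrector Φ₀ ω t)| ≤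
      (n : ℝ) ^ 2 * (c / 4 * n + |I|) + (c / 4 * (n : ℝ) ^ 3 + c / 4 * (n : ℝ) ^ 3) := by
    rw [htri]
    exact (abs_add_le _ _).trans (add_le_add hstart ((abs_sub _ _).trans (add_le_add hbt hbs)))
  have hn2 : (0 : ℝ) < (n : ℝ) ^ 2 := by positivity
  have hfin : (n : ℝ) ^ 2 * |corrector Φ₀ ω t x| ≤
      (n : ℝ) ^ 2 * (2 * C + R + (c / 4 * n + |I|) + (c / 4 * n + c / 4 * n)) := by
    linarith
  have := le_of_mul_le_mul_left hfin hn2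
  linarith

theorem card_ball_pos (n : ℕ) : 0 < (ball n).card := by
  rw [Finset.card_pos]
  exact ⟨0, by simp [ball]⟩

end DynRCM

/-! ### Averaging the pointwise bound over the parabolic box. -/

open DynRCM in
theorem mainTheorem3 (E : DynRCM.EnvSpace) (P : Measure E.Sample)
    (hP : DynRCM.StandingAssumption P) (Φ₀ : E.Sample → ℤ → ℝ)
    (hΦ : DynRCM.IsHarmonicField P Φ₀) :
    ∀ᵐ ω ∂P,
      (∀ (T : ℝ) (x : ℤ),
        IntervalIntegrable (fun t => DynRCM.corrector Φ₀ ω t x) volume 0 T) ∧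
      Tendsto (fun n : ℕ => 1 / (n : ℝ) ^ 2 *
          ∫ t in (0 : ℝ)..(n : ℝ) ^ 2, 1 / ((DynRCM.ball n).card : ℝ) *
            ∑ x ∈ DynRCM.ball n, |1 / (n : ℝ) * DynRCM.corrector Φ₀ ω t x|)
        atTop (𝓝 0) := by
  have := hP.prob
  have hT := hP.isSpaceTimeFlow
  filter_upwards [ae_intervalIntegrable_corrector hP hΦ.mem_cov, ae_corrector_bound hP hΦ,
    hT.ae_exists_forall_parabolic_le (measurable_gradError hP hΦ.mem_pot.1)
      (hΦ.mem_pot.exists_gradError_lt hP)] with ω hint hbound hmax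
  refine ⟨fun T x => hint x 0 T, ?_⟩
  rw [Metric.tendsto_nhds]
  intro ε hε
  -- One c comes from the pointwise bound and one from the averaged gradient error, and 2c < ε.
  set c := ε / 3 with hc
  have hc0 : 0 < c := by positivity
  obtain ⟨φ, hφ⟩ := hmax (ENNReal.ofReal c) (by simpa using hc0)
  filter_upwards [hbound c hc0 φ, eventually_ge_atTop 1] with n hn hn1
  have hnpos : (0 : ℝ) < n := by exact_mod_cast hn1
  have hcard : (0 : ℝ) < ((ball n).card : ℝ) := by exact_mod_cast card_ball_pos n
  have hgm := measurable_gradError hP hΦ.mem_pot.1 φ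
  have key : ‖∫ t in (0 : ℝ)..(n : ℝ) ^ 2, 1 / ((ball n).card : ℝ) *
      ∑ x ∈ ball n, |1 / (n : ℝ) * corrector Φ₀ ω t x|‖ₑ ≤
      ENNReal.ofReal (2 * c * (n : ℝ) ^ 2) := by
    rw [intervalIntegral.integral_of_le (by positivity)]
    refine (enorm_integral_le_lintegral_enorm _).trans ?_
    calc _ ≤ ∫⁻ t in Set.Ioc (0 : ℝ) ((n : ℝ) ^ 2), (ENNReal.ofReal c + ENNReal.ofReal (1 / n) *
            ∑ z ∈ ball n, gradError (fun ω x => (x : ℝ) - Φ₀ ω x) φ (tau t z ω)) := by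
          refine lintegral_mono_ae ((ae_restrict_iff' measurableSet_Ioc).2 ?_)
          filter_upwards [hn] with t ht htm
          simp only [gradError, Real.enorm_eq_ofReal_abs, Int.cast_one]
          rw [← ENNReal.ofReal_sum_of_nonneg fun _ _ => abs_nonneg _,
            ← ENNReal.ofReal_mul (by positivity),
            ← ENNReal.ofReal_add hc0.le (by positivity)]
          refine ENNReal.ofReal_le_ofReal ?_
          rw [abs_of_nonneg (by positivity), one_div_mul_eq_div, div_le_iff₀ hcard, mul_comm,
            ← nsmul_eq_mul]
          -- The bound is uniform in x, so the spatial average obeys it as well.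
          refine Finset.sum_le_card_nsmul _ _ _ fun x hx => ?_
          rw [abs_mul, abs_of_pos (by positivity : (0 : ℝ) < 1 / n)]
          refine (mul_le_mul_of_nonneg_left (ht htm x hx) (by positivity)).trans (le_of_eq ?_)
          field_simp
      _ = ENNReal.ofReal c * ENNReal.ofReal ((n : ℝ) ^ 2) + ENNReal.ofReal (1 / n) *
            ∑ z ∈ ball n, ∫⁻ t in Set.Ioc (0 : ℝ) ((n : ℝ) ^ 2),
              gradError (fun ω x => (x : ℝ) - Φ₀ ω x) φ (tau t z ω) := by
          have hm : ∀ z ∈ ball n, Measurable fun t =>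
              gradError (fun ω x => (x : ℝ) - Φ₀ ω x) φ (tau t z ω) :=
            fun z _ => hgm.comp (hT.measurable_time z ω)
          rw [lintegral_add_left measurable_const,
            lintegral_const_mul _ (Finset.measurable_fun_sum _ hm), lintegral_finsetSum _ hm]
          simp
      _ ≤ ENNReal.ofReal c * ENNReal.ofReal ((n : ℝ) ^ 2) + ENNReal.ofReal (1 / n) *
            (ENNReal.ofReal c * (n : ℝ≥0∞) ^ 3) := by
          gcongr
          exact hφ n hn1
      _ = ENNReal.ofReal (2 * c * (n : ℝ) ^ 2) := by
          rw [← ENNReal.ofReal_natCast, ← ENNReal.ofReal_pow hnpos.le, ← ENNReal.ofReal_mul hc0.le,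
            ← ENNReal.ofReal_mul hc0.le, ← ENNReal.ofReal_mul (by positivity),
            ← ENNReal.ofReal_add (by positivity) (by positivity)]
          congr 1
          field_simp
          ring
  rw [Real.enorm_eq_ofReal_abs, ENNReal.ofReal_le_ofReal_iff (by positivity)] at key
  rw [dist_zero_right, Real.norm_eq_abs, abs_mul, abs_of_pos (by positivity)]
  calc _ ≤ 1 / (n : ℝ) ^ 2 * (2 * c * (n : ℝ) ^ 2) := by gcongr
    _ = 2 * c := by field_simp
    _ < ε := by rw [hc]; linarith
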